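/- Notation. Let $n\ge 1$. A function $g:(0,\infty)\to(0,\infty)$ is almost decreasing if there is $C>0$ with $g(r)\ge C g(s)$ for all $0<r\le s$, and almost increasing if there is $C>0$ with $g(r)\le C g(s)$ for all $0<r\le s$. For $1\le p<\infty$, a measurable $\phi:(0,\infty)\to(0,\infty)$ is of class $\mathcal G_p$ if $\phi$ is almost decreasing and $\phi^p(r)r^n$ is almost increasing. The generalized Morrey space $L^{p,\phi}(\mathbb R^n)$ consists of all (real- or complex-valued) $f\in L^p_{\rm loc}(\mathbb R^n)$ with $$\|f\|_{L^{p,\phi}}:=\sup_{B=B(a,r)}\frac1{\phi(r)}\left(\frac1{|B|}\int_B|f(x)|^p\,dx\right)^{1/p}<\infty ,$$ and $\|f\|_{L^{p,q}}:=\sup_{B=B(a,r)}|B|^{\frac1q-\frac1p}\left(\int_B|f(x)|^p\,dx\right)^{1/p}$, the suprema being over all $a\in\mathbb R^n$ and $r>0$. For $0<\alpha<n$ and $\gamma\ge0$ put $$K_{\alpha,\gamma}(x):=\frac{|x|^{\alpha-n}}{(1+|x|)^\gamma},\qquad I_{\alpha,\gamma}f(x):=\int_{\mathbb R^n}K_{\alpha,\gamma}(x-y)f(y)\,dy,$$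 and $K_\alpha:=K_{\alpha,0}$, $I_\alpha:=I_{\alpha,0}$ (the fractional integral operator). Let $\|T\|_{X\to Y}:=\sup_{f\ne0}\|Tf\|_Y/\|f\|_X$, and let $s'$, $t'$ denote the dual exponents of $s$, $t$. Theorem 3.1. Let $0<\alpha<n$, $\gamma\ge0$, $1\le p_1<\frac n\alpha$, and let $\phi$ be of class $\mathcal G_{p_1}$ such that $\phi(r)r^n$ is almost increasing. Suppose that either (a) $1\le p_1<t$ and $1<s<t=\frac n{n-\alpha}$, or (b) $\gamma>0$, $1\le p_1\le t$, $1<s\le t$ and $\frac n{n+\gamma-\alpha}<t<\frac n{n-\alpha}$, and that there are constants $C_1,C_2,C_3>0$ such that for every $R>0$ (i) $\int_R^\infty\phi(r)r^{\frac n{t'}-1}\,dr\le C_1\,\phi(R)R^{\frac n{t'}}$, (ii) $\int_0^R\phi^{p_1}(r)r^{n-1}\,dr\le C_2\,\phi^{p_1}(R)R^n$, (iii) $\int_0^R\frac{r^{n-1}}{\phi^{s'}(r)r^{ns'}}\,dr\le\frac{C_3R^n}{\phi^{s'}(R)R^{ns'}}$. Let $\frac1{p_2}=\frac1{p_1}-\frac1{s'}$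 and $\psi(r):=\phi(r)r^{\frac n{t'}}$. Then $\|K_{\alpha,\gamma}\|_{L^{s,t}}<\infty$; for every $f\in L^{p_1,\phi}$ the integral defining $I_{\alpha,\gamma}f(x)$ converges absolutely for almost every $x$, and $I_{\alpha,\gamma}f\in L^{p_2,\psi}$; and $$C_4\|K_{\alpha,\gamma}\|_{L^{p_1,t}}\le\|I_{\alpha,\gamma}\|_{L^{p_1,\phi}\to L^{p_2,\psi}}\le C_5\|K_{\alpha,\gamma}\|_{L^{s,t}},$$ where $C_4,C_5>0$ depend on $\phi,n,p_1,s,t$ but not on $\alpha$ and $\gamma$. In particular, for $\gamma=0$ and under (a), $$C_4\|K_\alpha\|_{L^{p_1,t}}\le\|I_\alpha\|_{L^{p_1,\phi}\to L^{p_2,\psi}}\le C_5\|K_\alpha\|_{L^{s,t}}.$$ -/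

import Mathlib

open MeasureTheory Set
open scoped ENNReal

noncomputable section

/-- `g` is almost decreasing on `(0, ∞)`. -/
def AlmostDecreasing (g : ℝ → ℝ) : Prop :=
  ∃ C : ℝ, 0 < C ∧ ∀ r s : ℝ, 0 < r → r ≤ s → C * g s ≤ g r

/-- `g` is almost increasing on `(0, ∞)`. -/
def AlmostIncreasing (g : ℝ → ℝ) : Prop :=
  ∃ C : ℝ, 0 < C ∧ ∀ r s : ℝ, 0 < r → r ≤ s → g r ≤ C * g s

/-- `φ : (0, ∞) → (0, ∞)` is of class `𝒢_p` (in dimension `n`). Only the values of `φ` on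
`(0, ∞)` matter; `φ` is (Lebesgue) measurable there. -/
structure IsClassG (n : ℕ) (p : ℝ) (φ : ℝ → ℝ) : Prop where
  pos : ∀ r : ℝ, 0 < r → 0 < φ r
  aemeasurable : AEMeasurable φ (volume.restrict (Ioi (0 : ℝ)))
  almostDecreasing : AlmostDecreasing φ
  almostIncreasing : AlmostIncreasing fun r => φ r ^ p * r ^ (n : ℝ)

section Morrey

variable {n : ℕ} {F : Type*} [NormedAddCommGroup F]

/-- `f ∈ L^p_loc(ℝⁿ)`. -/
def MemLpLoc (p : ℝ) (f : EuclideanSpace ℝ (Fin n) → F) : Prop :=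
  ∀ A : Set (EuclideanSpace ℝ (Fin n)), IsCompact A →
    MemLp f (ENNReal.ofReal p) (volume.restrict A)

/-- The generalized Morrey norm
`sup_{B = B(a,r)} φ(r)⁻¹ (|B|⁻¹ ∫_B |f|^p)^{1/p}`, with values in `[0, ∞]`. -/
def genMorreyNorm (p : ℝ) (φ : ℝ → ℝ) (f : EuclideanSpace ℝ (Fin n) → F) : ℝ≥0∞ :=
  ⨆ (a : EuclideanSpace ℝ (Fin n)) (r : ℝ) (_ : 0 < r),
    (ENNReal.ofReal (φ r))⁻¹ *
      ((volume (Metric.ball a r))⁻¹ * ∫⁻ x in Metric.ball a r, ‖f x‖ₑ ^ p) ^ (1 / p)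

/-- `f` belongs to the generalized Morrey space `L^{p,φ}(ℝⁿ)`. -/
def MemGenMorrey (p : ℝ) (φ : ℝ → ℝ) (f : EuclideanSpace ℝ (Fin n) → F) : Prop :=
  MemLpLoc p f ∧ genMorreyNorm p φ f < ∞

/-- The classical Morrey norm
`sup_{B = B(a,r)} |B|^{1/q - 1/p} (∫_B |f|^p)^{1/p}`, with values in `[0, ∞]`. -/
def morreyNorm (p q : ℝ) (f : EuclideanSpace ℝ (Fin n) → F) : ℝ≥0∞ :=
  ⨆ (a : EuclideanSpace ℝ (Fin n)) (r : ℝ) (_ : 0 < r),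
    volume (Metric.ball a r) ^ (1 / q - 1 / p) *
      (∫⁻ x in Metric.ball a r, ‖f x‖ₑ ^ p) ^ (1 / p)

/-- The operator norm `sup_{f ≠ 0} ‖T f‖ / ‖f‖` from `L^{p₁,φ}` to `L^{p₂,ψ}`; here `f ≠ 0` is
meant almost everywhere, that is, `‖f‖ ≠ 0`. -/
def morreyOpNorm (p₁ : ℝ) (φ : ℝ → ℝ) (p₂ : ℝ) (ψ : ℝ → ℝ)
    (T : (EuclideanSpace ℝ (Fin n) → F) → (EuclideanSpace ℝ (Fin n) → F)) : ℝ≥0∞ :=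
  ⨆ (f : EuclideanSpace ℝ (Fin n) → F) (_ : MemGenMorrey p₁ φ f)
    (_ : genMorreyNorm p₁ φ f ≠ 0), genMorreyNorm p₂ ψ (T f) / genMorreyNorm p₁ φ f

end Morrey

/-- The Bessel-Riesz kernel `K_{α,γ}(x) = |x|^{α-n} / (1+|x|)^γ`. -/
def besselRieszKernel {n : ℕ} (α γ : ℝ) (x : EuclideanSpace ℝ (Fin n)) : ℝ :=
  ‖x‖ ^ (α - n) / (1 + ‖x‖) ^ γ

/-- The kernel `K_α(x) = |x|^{α-n}` of the fractional integral operator. -/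
def rieszKernel {n : ℕ} (α : ℝ) (x : EuclideanSpace ℝ (Fin n)) : ℝ :=
  ‖x‖ ^ (α - n)

section Operators

variable {n : ℕ} {𝕜 : Type*} [RCLike 𝕜]

/-- The Bessel-Riesz operator `I_{α,γ} f (x) = ∫ K_{α,γ}(x-y) f(y) dy`. -/
def besselRiesz (α γ : ℝ) (f : EuclideanSpace ℝ (Fin n) → 𝕜) : EuclideanSpace ℝ (Fin n) → 𝕜 :=
  fun x => ∫ y, besselRieszKernel α γ (x - y) • f y

/-- The fractional integral operator `I_α f (x) = ∫ K_α(x-y) f(y) dy`. -/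
def fractionalIntegral (α : ℝ) (f : EuclideanSpace ℝ (Fin n) → 𝕜) :
    EuclideanSpace ℝ (Fin n) → 𝕜 :=
  fun x => ∫ y, rieszKernel α (x - y) • f y

end Operators

end

/-! The constants can be uniform in α and γ because the kernel K enters the estimates only through
its sign, its radial decrease and its Morrey norm.

Upper bound. Since 1/s' = 1 - 1/s, the relation between the exponents reads 1/p₂ = 1/p₁ + 1/s - 1,
which is that of Young's inequality. Fix a ball B(a,R) and cut f at B(a,2R). The near part is
handled by `lintegral_conv_Lp_le`, with K cut to B(0,3R). For the far part, radial decrease turns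
the Morrey norm into the pointwise bound K(x) ≤ C ‖K‖ |x|^(-n/t)
(`enorm_le_of_radial_of_centered_le`), and a layer-cake argument reduces the tail to condition (i).
Both are combined in `exists_average_lintegral_conv_le`.

Lower bound. The potential of the indicator of B(0,2R) is at least ∫_{B(0,R)} K on B(0,R). Hence the
operator norm controls the centred L^{1,t} norm of K, so K(x) ≤ C ‖I‖ |x|^(-n/t) by radial decrease,
and this power lies in L^{p₁,t} as soon as p₁ < t. The strict inequality comes from (ii) and (iii),
which together force p₁ < s (`lt_of_lintegral_Ioo_ne_top`). -/

noncomputable section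

/-! ### Young's convolution inequality. -/

/-- **Young's convolution inequality** for nonnegative functions. -/
theorem lintegral_conv_Lp_le {G : Type*} [AddCommGroup G] [MeasurableSpace G] [MeasurableAdd₂ G]
    [MeasurableNeg G] {μ : Measure G} [SFinite μ] [μ.IsAddLeftInvariant] [μ.IsNegInvariant]
    {k g : G → ℝ≥0∞} (hk : Measurable k) (hg : AEMeasurable g μ) {p q s : ℝ} (hp : 1 ≤ p)
    (hs : 1 ≤ s) (hq : 0 < q) (hpqs : 1 / q = 1 / p + 1 / s - 1) :
    (∫⁻ x, (∫⁻ y, k (x - y) * g y ∂μ) ^ q ∂μ) ^ (1 / q) ≤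
      (∫⁻ x, k x ^ s ∂μ) ^ (1 / s) * (∫⁻ x, g x ^ p ∂μ) ^ (1 / p) := by
  wlog hg' : Measurable g generalizing g
  · have h := this hg.measurable_mk.aemeasurable hg.measurable_mk
    have h1 : ∀ x, ∫⁻ y, k (x - y) * hg.mk g y ∂μ = ∫⁻ y, k (x - y) * g y ∂μ := fun x =>
      lintegral_congr_ae (by filter_upwards [hg.ae_eq_mk] with y hy; rw [hy])
    have h2 : ∫⁻ y, hg.mk g y ^ p ∂μ = ∫⁻ y, g y ^ p ∂μ :=
      lintegral_congr_ae (by filter_upwards [hg.ae_eq_mk] with y hy; rw [hy])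
    simpa only [h1, h2] using h
  have hp0 : 0 < p := by linarith
  have hs0 : 0 < s := by linarith
  have hp1 : 1 / p ≤ 1 := by rw [div_le_one hp0]; exact hp
  have hs1 : 1 / s ≤ 1 := by rw [div_le_one hs0]; exact hs
  have hq1 : 0 < 1 / q := by positivity
  set A := ∫⁻ x, k x ^ s ∂μ with hA
  set B := ∫⁻ x, g x ^ p ∂μ with hB
  -- The classical three-factor splitting: the exponents 1/q, 1 - 1/p and 1 - 1/s sum to 1, so
  -- Hölder applies; Tonelli then integrates the first factor.
  have hpt : ∀ a b : ℝ≥0∞, a * b = (a ^ s * b ^ p) ^ (1 / q) *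
      ((a ^ s) ^ (1 - 1 / p) * (b ^ p) ^ (1 - 1 / s)) := by
    intro a b
    rw [ENNReal.mul_rpow_of_nonneg _ _ hq1.le, ← ENNReal.rpow_mul, ← ENNReal.rpow_mul,
      ← ENNReal.rpow_mul, ← ENNReal.rpow_mul, mul_mul_mul_comm,
      ← ENNReal.rpow_add_of_nonneg _ _ (by positivity) (mul_nonneg hs0.le (by linarith)),
      ← ENNReal.rpow_add_of_nonneg _ _ (by positivity) (mul_nonneg hp0.le (by linarith)), hpqs]
    have e1 : s * (1 / p + 1 / s - 1) + s * (1 - 1 / p) = 1 := by field_simp; ring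
    have e2 : p * (1 / p + 1 / s - 1) + p * (1 - 1 / s) = 1 := by field_simp; ring
    rw [e1, e2, ENNReal.rpow_one, ENNReal.rpow_one]
  have hkx : ∀ x, Measurable fun y => k (x - y) := fun x => hk.comp (measurable_const.sub measurable_id)
  have hconv : ∀ x, (∫⁻ y, k (x - y) * g y ∂μ) ≤
      (∫⁻ y, k (x - y) ^ s * g y ^ p ∂μ) ^ (1 / q) * (A ^ (1 - 1 / p) * B ^ (1 - 1 / s)) := by
    intro x
    have hh := ENNReal.lintegral_prod_norm_pow_le (μ := μ) (Finset.univ : Finset (Fin 3))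
      (f := ![fun y => k (x - y) ^ s * g y ^ p, fun y => k (x - y) ^ s, fun y => g y ^ p])
      (p := ![1 / q, 1 - 1 / p, 1 - 1 / s]) (by
        intro i _
        have := hkx x
        fin_cases i
        · exact (((hkx x).pow_const s).mul (hg'.pow_const p)).aemeasurable
        · exact ((hkx x).pow_const s).aemeasurable
        · exact (hg'.pow_const p).aemeasurable)
      (by simp [Fin.sum_univ_three]; simp only [one_div] at hpqs; linarith)
      (by intro i _; fin_cases i <;> simp <;> first | positivity | (simp only [one_div] at *; linarith))
    simp only [Fin.prod_univ_three, Matrix.cons_val_zero, Matrix.cons_val_one, Matrix.cons_val] at hh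
    rw [lintegral_sub_left_eq_self (fun y => k y ^ s) x] at hh
    calc _ = _ := lintegral_congr fun y => by rw [hpt, ← mul_assoc]
      _ ≤ _ := hh
      _ = _ := by rw [mul_assoc]
  have hmeas : Measurable fun z : G × G => k (z.1 - z.2) ^ s * g z.2 ^ p :=
    ((hk.comp (measurable_fst.sub measurable_snd)).pow_const s).mul
      ((hg'.comp measurable_snd).pow_const p)
  have hfub : ∫⁻ x, ∫⁻ y, k (x - y) ^ s * g y ^ p ∂μ ∂μ = A * B := by
    rw [lintegral_lintegral_swap hmeas.aemeasurable]
    have : ∀ y, ∫⁻ x, k (x - y) ^ s * g y ^ p ∂μ = A * g y ^ p := by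
      intro y
      have hky : Measurable fun x => k (x - y) ^ s :=
        (hk.comp (measurable_id.sub measurable_const)).pow_const s
      rw [lintegral_mul_const _ hky, lintegral_sub_right_eq_self (fun x => k x ^ s) y]
    simp_rw [this]
    rw [lintegral_const_mul _ (hg'.pow_const p)]
  calc (∫⁻ x, (∫⁻ y, k (x - y) * g y ∂μ) ^ q ∂μ) ^ (1 / q)
      ≤ (∫⁻ x, (∫⁻ y, k (x - y) ^ s * g y ^ p ∂μ) *
          (A ^ (1 - 1 / p) * B ^ (1 - 1 / s)) ^ q ∂μ) ^ (1 / q) := by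
        gcongr with x
        refine (ENNReal.rpow_le_rpow (hconv x) hq.le).trans_eq ?_
        rw [ENNReal.mul_rpow_of_nonneg _ _ hq.le, ← ENNReal.rpow_mul, one_div_mul_cancel hq.ne',
          ENNReal.rpow_one]
    _ = (A * B) ^ (1 / q) * (A ^ (1 - 1 / p) * B ^ (1 - 1 / s)) := by
        rw [lintegral_mul_const _ (Measurable.lintegral_prod_right' hmeas), hfub,
          ENNReal.mul_rpow_of_nonneg _ _ hq1.le, ← ENNReal.rpow_mul, mul_one_div_cancel hq.ne',
          ENNReal.rpow_one]
    _ = _ := by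
        rw [ENNReal.mul_rpow_of_nonneg _ _ hq1.le, mul_mul_mul_comm,
          ← ENNReal.rpow_add_of_nonneg _ _ hq1.le (by linarith),
          ← ENNReal.rpow_add_of_nonneg _ _ hq1.le (by linarith), hpqs]
        congr 2 <;> ring

/-! ### Volumes of balls and integrals of powers of the norm over balls. -/

/-- The volume of the unit ball of `ℝⁿ`. -/
def unitBallVolume (n : ℕ) : ℝ :=
  volume.real (Metric.ball (0 : EuclideanSpace ℝ (Fin n)) 1)

theorem unitBallVolume_pos (n : ℕ) : 0 < unitBallVolume n :=
  ENNReal.toReal_pos (Metric.measure_ball_pos _ _ one_pos).ne' measure_ball_lt_top.ne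

variable {n : ℕ}

theorem volume_ball_eq (a : EuclideanSpace ℝ (Fin n)) {r : ℝ} (hr : 0 < r) :
    volume (Metric.ball a r) = ENNReal.ofReal (unitBallVolume n * r ^ (n : ℝ)) := by
  rw [Measure.addHaar_ball_of_pos _ _ hr, unitBallVolume, mul_comm,
    ENNReal.ofReal_mul measureReal_nonneg, ofReal_measureReal measure_ball_lt_top.ne,
    finrank_euclideanSpace_fin, Real.rpow_natCast]

theorem volume_ball_rpow (a : EuclideanSpace ℝ (Fin n)) {r : ℝ} (hr : 0 < r) (c : ℝ) :
    volume (Metric.ball a r) ^ c =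
      ENNReal.ofReal (unitBallVolume n ^ c * r ^ ((n : ℝ) * c)) := by
  have := unitBallVolume_pos n
  rw [volume_ball_eq a hr, ENNReal.ofReal_rpow_of_pos (by positivity),
    Real.mul_rpow this.le (by positivity), ← Real.rpow_mul hr.le]

/-- Dilation by r. Both sides may be infinite, so no bound on `b` is needed. -/
theorem lintegral_ball_zero_norm_rpow_neg (b : ℝ) {r : ℝ} (hr : 0 < r) :
    ∫⁻ x in Metric.ball (0 : EuclideanSpace ℝ (Fin n)) r, ENNReal.ofReal (‖x‖ ^ (-b)) =
      ENNReal.ofReal (r ^ ((n : ℝ) - b)) *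
        ∫⁻ x in Metric.ball (0 : EuclideanSpace ℝ (Fin n)) 1, ENNReal.ofReal (‖x‖ ^ (-b)) := by
  have hmap := Measure.map_addHaar_smul (volume : Measure (EuclideanSpace ℝ (Fin n))) hr.ne'
  have hpre : (fun x : EuclideanSpace ℝ (Fin n) => r • x) ⁻¹' Metric.ball 0 r = Metric.ball 0 1 := by
    ext x
    simp [norm_smul, abs_of_pos hr, mul_lt_iff_lt_one_right hr]
  have hm : Measurable fun x : EuclideanSpace ℝ (Fin n) => ENNReal.ofReal (‖x‖ ^ (-b)) := by fun_prop
  have h1 : ∫⁻ x in Metric.ball (0 : EuclideanSpace ℝ (Fin n)) r, ENNReal.ofReal (‖x‖ ^ (-b))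
      ∂(Measure.map (fun x : EuclideanSpace ℝ (Fin n) => r • x) volume) =
      ∫⁻ x in Metric.ball (0 : EuclideanSpace ℝ (Fin n)) 1, ENNReal.ofReal (‖r • x‖ ^ (-b)) := by
    rw [setLIntegral_map Metric.isOpen_ball.measurableSet hm (by fun_prop), hpre]
  rw [show (fun x : EuclideanSpace ℝ (Fin n) => r • x) = (r • ·) from rfl, hmap,
    Measure.restrict_smul, lintegral_smul_measure, finrank_euclideanSpace_fin] at h1
  have h2 : ∀ x : EuclideanSpace ℝ (Fin n), ENNReal.ofReal (‖r • x‖ ^ (-b)) =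
      ENNReal.ofReal (r ^ (-b)) * ENNReal.ofReal (‖x‖ ^ (-b)) := by
    intro x
    rw [norm_smul, Real.norm_of_nonneg hr.le, Real.mul_rpow hr.le (norm_nonneg _),
      ENNReal.ofReal_mul (by positivity)]
  simp_rw [h2] at h1
  rw [lintegral_const_mul _ hm, smul_eq_mul, abs_of_pos (by positivity)] at h1
  rw [sub_eq_add_neg, Real.rpow_add hr, ENNReal.ofReal_mul (by positivity), mul_assoc, ← h1,
    ← mul_assoc, ← ENNReal.ofReal_mul (by positivity), Real.rpow_natCast,
    mul_inv_cancel₀ (by positivity), ENNReal.ofReal_one, one_mul]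

/-- Uniformity in the centre: points of B(a,r) inside B(0,r) are covered by the centred integral,
which scales, and elsewhere the integrand is at most r^(-b). -/
theorem exists_lintegral_ball_norm_rpow_neg_le (hn : 1 ≤ n) {b : ℝ} (hb : 0 ≤ b) (hbn : b < n) :
    ∃ c : ℝ, 0 < c ∧ ∀ (a : EuclideanSpace ℝ (Fin n)) (r : ℝ), 0 < r →
      ∫⁻ x in Metric.ball a r, ENNReal.ofReal (‖x‖ ^ (-b)) ≤
        ENNReal.ofReal (c * r ^ ((n : ℝ) - b)) := by
  have hfin : ∫⁻ x in Metric.ball (0 : EuclideanSpace ℝ (Fin n)) 1, ENNReal.ofReal (‖x‖ ^ (-b))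
      < ∞ := by
    have h := integrableOn_ball_of_norm_le_rpow
      (μ := (volume : Measure (EuclideanSpace ℝ (Fin n)))) (f := fun x => ‖x‖ ^ (-b))
      (C := 1) (α := b) (r := 1) (by simpa using hn) (by simpa using hbn)
      (Filter.Eventually.of_forall fun x => by
        rw [Real.norm_of_nonneg (by positivity), one_mul])
      (measurable_norm.pow_const _).aestronglyMeasurable
    exact h.lintegral_lt_top
  set J := ∫⁻ x in Metric.ball (0 : EuclideanSpace ℝ (Fin n)) 1, ENNReal.ofReal (‖x‖ ^ (-b))
    with hJ
  have hω := unitBallVolume_pos n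
  refine ⟨J.toReal + unitBallVolume n, by positivity, fun a r hr => ?_⟩
  have hpt : ∀ x : EuclideanSpace ℝ (Fin n), ENNReal.ofReal (‖x‖ ^ (-b)) ≤
      (Metric.ball (0 : EuclideanSpace ℝ (Fin n)) r).indicator
        (fun x => ENNReal.ofReal (‖x‖ ^ (-b))) x + ENNReal.ofReal (r ^ (-b)) := by
    intro x
    by_cases hx : x ∈ Metric.ball (0 : EuclideanSpace ℝ (Fin n)) r
    · rw [indicator_of_mem hx]; exact le_self_add
    · rw [indicator_of_notMem hx, zero_add]
      refine ENNReal.ofReal_le_ofReal (Real.rpow_le_rpow_of_nonpos hr ?_ (by linarith))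
      simpa using hx
  calc _ ≤ ∫⁻ x in Metric.ball a r, ((Metric.ball (0 : EuclideanSpace ℝ (Fin n)) r).indicator
        (fun x => ENNReal.ofReal (‖x‖ ^ (-b))) x + ENNReal.ofReal (r ^ (-b))) :=
        lintegral_mono fun x => hpt x
    _ ≤ (∫⁻ x in Metric.ball (0 : EuclideanSpace ℝ (Fin n)) r, ENNReal.ofReal (‖x‖ ^ (-b))) +
        ENNReal.ofReal (r ^ (-b)) * volume (Metric.ball a r) := by
        rw [lintegral_add_right _ measurable_const, setLIntegral_const]
        refine add_le_add ?_ le_rfl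
        exact (setLIntegral_le_lintegral _ _).trans_eq
          (lintegral_indicator Metric.isOpen_ball.measurableSet _)
    _ = _ := by
        rw [lintegral_ball_zero_norm_rpow_neg b hr, ← hJ, volume_ball_eq a hr, add_mul,
          ENNReal.ofReal_add (by positivity) (by positivity), ← ENNReal.ofReal_mul (by positivity),
          mul_comm, ENNReal.ofReal_mul ENNReal.toReal_nonneg, ENNReal.ofReal_toReal hfin.ne]
        congr 2
        rw [sub_eq_add_neg, Real.rpow_add hr]
        ring

/-! ### Morrey norms of powers and decay of radially decreasing functions. -/

section

variable {F F' : Type*} [NormedAddCommGroup F] [NormedAddCommGroup F']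

theorem morreyNorm_le_mul {q t : ℝ} (hq : 0 < q) {C : ℝ≥0∞} (hC : C ≠ ∞)
    {f : EuclideanSpace ℝ (Fin n) → F} {g : EuclideanSpace ℝ (Fin n) → F'}
    (h : ∀ᵐ x, ‖f x‖ₑ ≤ C * ‖g x‖ₑ) :
    morreyNorm q t f ≤ C * morreyNorm q t g := by
  refine iSup_le fun a => iSup_le fun r => iSup_le fun hr => ?_
  calc volume (Metric.ball a r) ^ (1 / t - 1 / q) *
      (∫⁻ x in Metric.ball a r, ‖f x‖ₑ ^ q) ^ (1 / q)
      ≤ volume (Metric.ball a r) ^ (1 / t - 1 / q) *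
      (∫⁻ x in Metric.ball a r, C ^ q * ‖g x‖ₑ ^ q) ^ (1 / q) := by
        refine mul_le_mul_right ?_ _
        refine ENNReal.rpow_le_rpow (lintegral_mono_ae ?_) (by positivity)
        filter_upwards [ae_restrict_of_ae h] with x hx
        rw [← ENNReal.mul_rpow_of_nonneg _ _ hq.le]
        exact ENNReal.rpow_le_rpow hx hq.le
    _ = C * (volume (Metric.ball a r) ^ (1 / t - 1 / q) *
      (∫⁻ x in Metric.ball a r, ‖g x‖ₑ ^ q) ^ (1 / q)) := by
        rw [lintegral_const_mul' _ _ (ENNReal.rpow_ne_top_of_nonneg hq.le hC),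
          ENNReal.mul_rpow_of_nonneg _ _ (by positivity), ← ENNReal.rpow_mul,
          mul_one_div_cancel hq.ne', ENNReal.rpow_one, mul_left_comm]
    _ ≤ _ := by
        refine mul_le_mul_right ?_ _
        exact le_iSup_of_le a (le_iSup_of_le r (le_iSup_of_le hr le_rfl))

/-- The function `|x|^{-n/t}` lies in the Morrey space `L^{q,t}` for `q < t`. -/
theorem exists_morreyNorm_norm_rpow_le (hn : 1 ≤ n) {q t : ℝ} (hq : 0 < q) (hqt : q < t) :
    ∃ c : ℝ, 0 < c ∧
      morreyNorm q t (fun x : EuclideanSpace ℝ (Fin n) => ‖x‖ ^ (-((n : ℝ) / t))) ≤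
        ENNReal.ofReal c := by
  have ht : 0 < t := hq.trans hqt
  have hn0 : (0 : ℝ) < n := by exact_mod_cast hn
  -- Local integrability of |x|^(-nq/t) is exactly q < t.
  obtain ⟨c, hc, hcb⟩ := exists_lintegral_ball_norm_rpow_neg_le hn (b := n / t * q)
    (by positivity) (by rw [div_mul_eq_mul_div, div_lt_iff₀ ht]; gcongr)
  have hω := unitBallVolume_pos n
  refine ⟨unitBallVolume n ^ (1 / t - 1 / q) * c ^ (1 / q), by positivity, ?_⟩
  refine iSup_le fun a => iSup_le fun r => iSup_le fun hr => ?_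
  have h1 : ∀ x : EuclideanSpace ℝ (Fin n), ‖‖x‖ ^ (-((n : ℝ) / t))‖ₑ ^ q =
      ENNReal.ofReal (‖x‖ ^ (-((n : ℝ) / t * q))) := by
    intro x
    rw [Real.enorm_eq_ofReal (by positivity),
      ENNReal.ofReal_rpow_of_nonneg (by positivity) hq.le, ← Real.rpow_mul (norm_nonneg _), neg_mul]
  simp_rw [h1]
  refine (mul_le_mul_right (ENNReal.rpow_le_rpow (hcb a r hr) (by positivity)) _).trans_eq ?_
  rw [volume_ball_rpow a hr, ENNReal.ofReal_rpow_of_pos (by positivity),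
    ← ENNReal.ofReal_mul (by positivity), Real.mul_rpow hc.le (by positivity),
    ← Real.rpow_mul hr.le, mul_mul_mul_comm, ← Real.rpow_add hr]
  -- Scale invariance: all powers of r cancel.
  have : (n : ℝ) * (1 / t - 1 / q) + (n - n / t * q) * (1 / q) = 0 := by
    field_simp; ring
  rw [this, Real.rpow_zero, mul_one]

/-- A radially decreasing function whose centred Morrey norm is at most `M` decays like
`M |x|^{-n/t}`. -/
theorem enorm_le_of_radial_of_centered_le {q t : ℝ} (hn : 1 ≤ n) (hq : 0 < q)
    {f : EuclideanSpace ℝ (Fin n) → F}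
    (hf : ∀ x z : EuclideanSpace ℝ (Fin n), z ≠ 0 → ‖z‖ ≤ ‖x‖ → ‖f x‖ₑ ≤ ‖f z‖ₑ) {M : ℝ≥0∞}
    (hM : ∀ r : ℝ, 0 < r → volume (Metric.ball (0 : EuclideanSpace ℝ (Fin n)) r) ^ (1 / t - 1 / q) *
      (∫⁻ x in Metric.ball 0 r, ‖f x‖ₑ ^ q) ^ (1 / q) ≤ M)
    {x : EuclideanSpace ℝ (Fin n)} (hx : x ≠ 0) :
    ‖f x‖ₑ ≤ ENNReal.ofReal (unitBallVolume n ^ (-(1 / t)) * ‖x‖ ^ (-((n : ℝ) / t))) * M := by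
  have hx0 : 0 < ‖x‖ := norm_pos_iff.2 hx
  have hω := unitBallVolume_pos n
  have : Nonempty (Fin n) := ⟨⟨0, hn⟩⟩
  set B := Metric.ball (0 : EuclideanSpace ℝ (Fin n)) ‖x‖ with hB
  have hB0 : volume B ≠ 0 := (Metric.measure_ball_pos _ _ hx0).ne'
  have hBt : volume B ≠ ∞ := measure_ball_lt_top.ne
  -- On the ball of radius |x| every value of f off the origin dominates f(x), so the mean over that
  -- ball does too.
  have h1 : ‖f x‖ₑ ^ q * volume B ≤ ∫⁻ z in B, ‖f z‖ₑ ^ q := by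
    rw [← setLIntegral_const]
    refine lintegral_mono_ae ?_
    filter_upwards [ae_restrict_mem Metric.isOpen_ball.measurableSet,
      ae_restrict_of_ae (Measure.ae_ne volume (0 : EuclideanSpace ℝ (Fin n)))] with z hz hz0
    refine ENNReal.rpow_le_rpow (hf x z hz0 ?_) hq.le
    simpa using (mem_ball_zero_iff.1 hz).le
  have h2 : ‖f x‖ₑ * volume B ^ (1 / t) ≤ M := by
    refine le_trans ?_ (hM ‖x‖ hx0)
    calc ‖f x‖ₑ * volume B ^ (1 / t)
        = volume B ^ (1 / t - 1 / q) * (‖f x‖ₑ ^ q * volume B) ^ (1 / q) := by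
          rw [ENNReal.mul_rpow_of_nonneg _ _ (by positivity), ← ENNReal.rpow_mul,
            mul_one_div_cancel hq.ne', ENNReal.rpow_one, mul_left_comm,
            ← ENNReal.rpow_add _ _ hB0 hBt, sub_add_cancel]
      _ ≤ _ := by gcongr
  have h3 : ENNReal.ofReal (unitBallVolume n ^ (-(1 / t)) * ‖x‖ ^ (-((n : ℝ) / t))) =
      volume B ^ (-(1 / t)) := by
    rw [hB, volume_ball_rpow _ hx0]; congr 3; ring
  rw [h3]
  calc ‖f x‖ₑ = volume B ^ (-(1 / t)) * (‖f x‖ₑ * volume B ^ (1 / t)) := by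
        rw [mul_left_comm, ← ENNReal.rpow_add _ _ hB0 hBt, neg_add_cancel, ENNReal.rpow_zero,
          mul_one]
    _ ≤ _ := by gcongr

end

/-! ### The Bessel-Riesz kernel and its Morrey norm. -/

section Kernel

variable {α γ : ℝ}

theorem besselRieszKernel_nonneg (x : EuclideanSpace ℝ (Fin n)) : 0 ≤ besselRieszKernel α γ x := by
  unfold besselRieszKernel; positivity

theorem measurable_besselRieszKernel :
    Measurable (besselRieszKernel α γ : EuclideanSpace ℝ (Fin n) → ℝ) :=
  (measurable_norm.pow_const _).div ((measurable_const.add measurable_norm).pow_const _)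

/-- The origin is excluded because `0 ^ (α - n) = 0` for α < n: there the kernel takes the value 0
instead of a maximum. -/
theorem besselRieszKernel_le_of_norm_le (hα : α ≤ n) (hγ : 0 ≤ γ)
    {x z : EuclideanSpace ℝ (Fin n)} (hz : z ≠ 0) (hzx : ‖z‖ ≤ ‖x‖) :
    besselRieszKernel α γ x ≤ besselRieszKernel α γ z := by
  have := norm_pos_iff.2 hz
  unfold besselRieszKernel
  have h := Real.rpow_le_rpow_of_nonpos this hzx (sub_nonpos.2 hα)
  gcongr

theorem enorm_besselRieszKernel_le_of_norm_le (hα : α ≤ n) (hγ : 0 ≤ γ)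
    (x z : EuclideanSpace ℝ (Fin n)) (hz : z ≠ 0) (hzx : ‖z‖ ≤ ‖x‖) :
    ‖besselRieszKernel α γ x‖ₑ ≤ ‖besselRieszKernel α γ z‖ₑ := by
  rw [Real.enorm_eq_ofReal (besselRieszKernel_nonneg x),
    Real.enorm_eq_ofReal (besselRieszKernel_nonneg z)]
  exact ENNReal.ofReal_le_ofReal (besselRieszKernel_le_of_norm_le hα hγ hz hzx)

/-- The kernel behaves like |x|^(α-n) at the origin and like |x|^(α-n-γ) at infinity; the exponent
-β lies between the two. -/
theorem besselRieszKernel_le_norm_rpow {β : ℝ} (hγ : 0 ≤ γ) (h1 : -β ≤ α - n)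
    (h2 : α - n - γ ≤ -β) {x : EuclideanSpace ℝ (Fin n)} (hx : x ≠ 0) :
    besselRieszKernel α γ x ≤ ‖x‖ ^ (-β) := by
  have hx0 := norm_pos_iff.2 hx
  unfold besselRieszKernel
  rw [div_le_iff₀ (by positivity)]
  rcases le_total ‖x‖ 1 with h | h
  · calc ‖x‖ ^ (α - n) ≤ ‖x‖ ^ (-β) := Real.rpow_le_rpow_of_exponent_ge hx0 h h1
      _ ≤ _ := le_mul_of_one_le_right (by positivity)
          (Real.one_le_rpow (by linarith) hγ)
  · calc ‖x‖ ^ (α - n) ≤ ‖x‖ ^ (-β + γ) := Real.rpow_le_rpow_of_exponent_le h (by linarith)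
      _ = ‖x‖ ^ (-β) * ‖x‖ ^ γ := Real.rpow_add hx0 _ _
      _ ≤ _ := by gcongr; linarith

/-- The Bessel-Riesz kernel lies in `L^t` when `n/(n+γ-α) < t < n/(n-α)`. -/
theorem lintegral_besselRieszKernel_rpow_lt_top (hn : 1 ≤ n) (hα : α < n) (hγ : 0 ≤ γ) {t : ℝ}
    (ht : 0 < t) (h1 : (n - α) * t < n) (h2 : n < (n + γ - α) * t) :
    ∫⁻ x : EuclideanSpace ℝ (Fin n), ‖besselRieszKernel α γ x‖ₑ ^ t < ∞ := by
  set B := Metric.ball (0 : EuclideanSpace ℝ (Fin n)) 1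
  have hpow : ∀ x : EuclideanSpace ℝ (Fin n), ‖besselRieszKernel α γ x‖ₑ ^ t =
      ENNReal.ofReal (besselRieszKernel α γ x ^ t) := fun x => by
    rw [Real.enorm_eq_ofReal (besselRieszKernel_nonneg x),
      ENNReal.ofReal_rpow_of_nonneg (besselRieszKernel_nonneg x) ht.le]
  obtain ⟨c, hc, hcb⟩ := exists_lintegral_ball_norm_rpow_neg_le hn (b := (n - α) * t)
    (mul_nonneg (by linarith) ht.le) h1
  rw [← lintegral_add_compl _ (Metric.isOpen_ball.measurableSet : MeasurableSet B)]
  refine ENNReal.add_lt_top.2 ⟨?_, ?_⟩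
  · refine ((lintegral_mono fun x => ?_).trans (hcb 0 1 one_pos)).trans_lt ENNReal.ofReal_lt_top
    rw [hpow]
    refine ENNReal.ofReal_le_ofReal ?_
    rw [show -(((n : ℝ) - α) * t) = (α - n) * t by ring, Real.rpow_mul (norm_nonneg _)]
    refine Real.rpow_le_rpow (besselRieszKernel_nonneg x) ?_ ht.le
    exact div_le_self (by positivity) (Real.one_le_rpow (by linarith [norm_nonneg x]) hγ)
  -- Outside the unit ball |x| ≥ (1+|x|)/2, so K is at most 2^(n-α) (1+|x|)^(-(n+γ-α)), whose t-th
  -- power is integrable.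
  · have hint := finite_integral_one_add_norm
      (μ := (volume : Measure (EuclideanSpace ℝ (Fin n)))) (r := (n + γ - α) * t) (by simpa using h2)
    have hle : ∫⁻ x in Bᶜ, ‖besselRieszKernel α γ x‖ₑ ^ t ≤
        ENNReal.ofReal ((2 : ℝ) ^ ((n - α) * t)) * ∫⁻ x : EuclideanSpace ℝ (Fin n),
          ENNReal.ofReal ((1 + ‖x‖) ^ (-((n + γ - α) * t))) := by
      rw [← lintegral_const_mul' _ _ ENNReal.ofReal_ne_top]
      refine (setLIntegral_mono' Metric.isOpen_ball.measurableSet.compl fun x hx => ?_).trans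
        (setLIntegral_le_lintegral _ _)
      have hx1 : 1 ≤ ‖x‖ := by simpa [B] using hx
      rw [hpow, ← ENNReal.ofReal_mul (by positivity)]
      refine ENNReal.ofReal_le_ofReal ?_
      rw [Real.rpow_mul (by norm_num), ← neg_mul, Real.rpow_mul (by positivity),
        ← Real.mul_rpow (by positivity) (by positivity)]
      refine Real.rpow_le_rpow (besselRieszKernel_nonneg x) ?_ ht.le
      unfold besselRieszKernel
      rw [show -((n : ℝ) + γ - α) = (α - n) - γ by ring,
        Real.rpow_sub (show 0 < 1 + ‖x‖ by positivity) (α - n), ← mul_div_assoc]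
      gcongr
      calc ‖x‖ ^ (α - n) ≤ ((1 + ‖x‖) / 2) ^ (α - n) :=
            Real.rpow_le_rpow_of_nonpos (by positivity) (by linarith) (by linarith)
        _ = _ := by
            rw [Real.div_rpow (by positivity) (by norm_num), div_eq_mul_inv, mul_comm,
              ← Real.rpow_neg (by norm_num), neg_sub]
    exact hle.trans_lt (ENNReal.mul_lt_top ENNReal.ofReal_lt_top hint)

/-- The Bessel-Riesz kernel lies in the Morrey space `L^{s,t}`. -/
theorem morreyNorm_besselRieszKernel_lt_top (hn : 1 ≤ n) (hα : α < n) (hγ : 0 ≤ γ)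
    {s t : ℝ} (hs : 0 < s) (hst : s ≤ t)
    (h : (s < t ∧ t = n / (n - α)) ∨ (n / (n + γ - α) < t ∧ t < n / (n - α))) :
    morreyNorm s t (besselRieszKernel (n := n) α γ) < ∞ := by
  have ht : 0 < t := hs.trans_le hst
  have hn0 : (0 : ℝ) < n := by exact_mod_cast hn
  have hnα : 0 < (n : ℝ) - α := by linarith
  have : Nonempty (Fin n) := ⟨⟨0, hn⟩⟩
  have h12 : (n - α) * t ≤ n ∧ n ≤ (n + γ - α) * t := by
    rcases h with ⟨-, h⟩ | ⟨h1, h2⟩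
    · have : (n - α) * t = n := by rw [h]; field_simp
      exact ⟨this.le, by nlinarith⟩
    · rw [lt_div_iff₀ hnα] at h2
      rw [div_lt_iff₀ (by linarith)] at h1
      exact ⟨by linarith, by linarith⟩
  -- For s < t the kernel is dominated by |x|^(-n/t). The endpoint s = t occurs only under the
  -- second alternative, where K lies in L^t.
  rcases hst.lt_or_eq with hlt | rfl
  · obtain ⟨c, hc, hcb⟩ := exists_morreyNorm_norm_rpow_le hn hs hlt
    refine lt_of_le_of_lt (morreyNorm_le_mul (C := 1) hs (by simp)
      (g := fun x : EuclideanSpace ℝ (Fin n) => ‖x‖ ^ (-((n : ℝ) / t))) ?_)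
      (lt_of_le_of_lt ?_ (ENNReal.ofReal_lt_top (r := c)))
    · filter_upwards [Measure.ae_ne volume (0 : EuclideanSpace ℝ (Fin n))] with x hx
      rw [one_mul, Real.enorm_eq_ofReal (besselRieszKernel_nonneg x),
        Real.enorm_eq_ofReal (by positivity)]
      refine ENNReal.ofReal_le_ofReal (besselRieszKernel_le_norm_rpow hγ ?_ ?_ hx)
      · have : (n : ℝ) - α ≤ n / t := by rw [le_div_iff₀ ht]; exact h12.1
        linarith
      · have : (n : ℝ) / t ≤ n + γ - α := by rw [div_le_iff₀ ht]; exact h12.2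
        linarith
    · rw [one_mul]; exact hcb
  · rcases h with ⟨h, -⟩ | ⟨h1, h2⟩
    · exact absurd h (lt_irrefl _)
    rw [lt_div_iff₀ hnα] at h2
    rw [div_lt_iff₀ (by linarith)] at h1
    have hfin := lintegral_besselRieszKernel_rpow_lt_top hn hα hγ hs (by linarith) (by linarith)
    refine lt_of_le_of_lt (iSup_le fun a => iSup_le fun r => iSup_le fun hr => ?_)
      (ENNReal.rpow_lt_top_of_nonneg (y := 1 / s) (by positivity) hfin.ne)
    rw [sub_self, ENNReal.rpow_zero, one_mul]
    exact ENNReal.rpow_le_rpow (setLIntegral_le_lintegral _ _) (by positivity)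

end Kernel

/-! ### Local and tail estimates for convolutions on generalized Morrey spaces. -/

section

variable {F F' : Type*} [NormedAddCommGroup F] [NormedAddCommGroup F']

theorem MemLpLoc.aestronglyMeasurable {p : ℝ} {f : EuclideanSpace ℝ (Fin n) → F}
    (hf : MemLpLoc p f) : AEStronglyMeasurable f volume := by
  rw [← Measure.restrict_univ (μ := volume), ← Metric.iUnion_closedBall_nat (0 : EuclideanSpace ℝ (Fin n)),
    aestronglyMeasurable_iUnion_iff]
  exact fun k => (hf _ (isCompact_closedBall _ _)).1

theorem volume_ball_ne_zero (a : EuclideanSpace ℝ (Fin n)) {r : ℝ} (hr : 0 < r) :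
    volume (Metric.ball a r) ≠ 0 :=
  (Metric.measure_ball_pos _ _ hr).ne'

theorem lintegral_ball_rpow_le_genMorreyNorm {p : ℝ} {φ : ℝ → ℝ} (hp : 0 < p)
    (f : EuclideanSpace ℝ (Fin n) → F) (a : EuclideanSpace ℝ (Fin n)) {r : ℝ} (hr : 0 < r)
    (hφ : 0 < φ r) :
    (∫⁻ x in Metric.ball a r, ‖f x‖ₑ ^ p) ^ (1 / p) ≤
      volume (Metric.ball a r) ^ (1 / p) * (ENNReal.ofReal (φ r) * genMorreyNorm p φ f) := by
  have hB0 := volume_ball_ne_zero a hr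
  have hBt : volume (Metric.ball a r) ≠ ∞ := measure_ball_lt_top.ne
  have hφ0 : ENNReal.ofReal (φ r) ≠ 0 := by simpa using hφ
  have h : (ENNReal.ofReal (φ r))⁻¹ * ((volume (Metric.ball a r))⁻¹ *
      ∫⁻ x in Metric.ball a r, ‖f x‖ₑ ^ p) ^ (1 / p) ≤ genMorreyNorm p φ f :=
    le_iSup_of_le a (le_iSup_of_le r (le_iSup_of_le hr le_rfl))
  rw [ENNReal.inv_mul_le_iff hφ0 ENNReal.ofReal_ne_top] at h
  calc (∫⁻ x in Metric.ball a r, ‖f x‖ₑ ^ p) ^ (1 / p)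
      = volume (Metric.ball a r) ^ (1 / p) * ((volume (Metric.ball a r))⁻¹ *
      ∫⁻ x in Metric.ball a r, ‖f x‖ₑ ^ p) ^ (1 / p) := by
        rw [← ENNReal.mul_rpow_of_nonneg _ _ (by positivity), ← mul_assoc,
          ENNReal.mul_inv_cancel hB0 hBt, one_mul]
    _ ≤ _ := by gcongr

theorem lintegral_ball_le_genMorreyNorm {p : ℝ} {φ : ℝ → ℝ} (hp : 1 ≤ p)
    {f : EuclideanSpace ℝ (Fin n) → F} (hf : AEStronglyMeasurable f volume)
    (a : EuclideanSpace ℝ (Fin n)) {r : ℝ} (hr : 0 < r) (hφ : 0 < φ r) :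
    ∫⁻ x in Metric.ball a r, ‖f x‖ₑ ≤
      volume (Metric.ball a r) * (ENNReal.ofReal (φ r) * genMorreyNorm p φ f) := by
  have hp0 : 0 < p := by linarith
  have hp1 : 1 / p ≤ 1 := by rw [div_le_one hp0]; exact hp
  have h := ENNReal.lintegral_mul_norm_pow_le (μ := volume.restrict (Metric.ball a r))
    (f := fun x => ‖f x‖ₑ ^ p) (g := fun _ => 1) (hf.enorm.restrict.pow_const p) aemeasurable_const
    (p := 1 / p) (q := 1 - 1 / p) (by positivity) (by linarith) (by ring)
  simp only [← ENNReal.rpow_mul, mul_one_div_cancel hp0.ne', ENNReal.rpow_one, ENNReal.one_rpow,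
    mul_one, lintegral_const, one_mul, Measure.restrict_apply_univ] at h
  refine h.trans ((mul_le_mul_left
    (lintegral_ball_rpow_le_genMorreyNorm hp0 f a hr hφ) _).trans_eq ?_)
  rw [mul_right_comm, ← ENNReal.rpow_add_of_nonneg _ _ (by positivity) (by linarith),
    add_sub_cancel, ENNReal.rpow_one]

/-- Layer-cake form of the power c^(-b), used to write the potential of f as an integral over radii.
-/
theorem lintegral_Ioi_rpow_neg {b c : ℝ} (hb : 0 < b) (hc : 0 < c) :
    ∫⁻ r in Ioi c, ENNReal.ofReal (b * r ^ (-b - 1)) = ENNReal.ofReal (c ^ (-b)) := by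
  rw [← ofReal_integral_eq_lintegral_ofReal
    ((integrableOn_Ioi_rpow_of_lt (by linarith) hc).const_mul b), integral_const_mul,
    integral_Ioi_rpow_of_lt (by linarith) hc]
  · congr 1
    rw [sub_add_cancel]
    field_simp
  · filter_upwards [ae_restrict_mem measurableSet_Ioi] with r hr
    have : 0 < r := hc.trans hr
    positivity

/-- The tail of a power potential is controlled by the growth of the integrals over balls. -/
theorem lintegral_compl_ball_norm_rpow_mul_le {b R : ℝ} (hb : 0 < b) (hR : 0 < R)
    {g : EuclideanSpace ℝ (Fin n) → ℝ≥0∞} (hg : AEMeasurable g volume) {w : ℝ → ℝ≥0∞}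
    (x : EuclideanSpace ℝ (Fin n))
    (hw : ∀ r, R < r → ∫⁻ y in Metric.ball x r, g y ≤ w r) :
    ∫⁻ y in (Metric.ball x R)ᶜ, ENNReal.ofReal (‖x - y‖ ^ (-b)) * g y ≤
      ∫⁻ r in Ioi R, ENNReal.ofReal (b * r ^ (-b - 1)) * w r := by
  have hset : MeasurableSet {z : EuclideanSpace ℝ (Fin n) × ℝ | ‖x - z.1‖ < z.2} :=
    measurableSet_lt (by fun_prop) measurable_snd
  -- Integrating h(y,r) over r > R recovers |x-y|^(-b) for y outside B(x,R); integrating over y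
  -- first leaves balls around x.
  set h : EuclideanSpace ℝ (Fin n) × ℝ → ℝ≥0∞ :=
    {z : EuclideanSpace ℝ (Fin n) × ℝ | ‖x - z.1‖ < z.2}.indicator
      fun z => ENNReal.ofReal (b * z.2 ^ (-b - 1)) with hh
  have hmeas : Measurable h :=
    (ENNReal.measurable_ofReal.comp ((measurable_snd.pow_const _).const_mul b)).indicator hset
  have h1 : ∀ y ∈ (Metric.ball x R)ᶜ, ENNReal.ofReal (‖x - y‖ ^ (-b)) * g y =
      ∫⁻ r in Ioi R, h (y, r) * g y := by
    intro y hy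
    have hxy : R ≤ ‖x - y‖ := by
      rw [← dist_eq_norm, dist_comm]
      simpa using hy
    have hmy : Measurable fun r => h (y, r) := hmeas.comp measurable_prodMk_left
    rw [lintegral_mul_const _ hmy]
    congr 1
    have : (fun r => h (y, r)) = (Ioi ‖x - y‖).indicator
        fun r => ENNReal.ofReal (b * r ^ (-b - 1)) := by
      ext r
      simp [hh, indicator]
    rw [this, setLIntegral_indicator measurableSet_Ioi, Ioi_inter_Ioi, max_eq_left hxy,
      lintegral_Ioi_rpow_neg hb (hR.trans_le hxy)]
  rw [setLIntegral_congr_fun Metric.isOpen_ball.measurableSet.compl h1,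
    lintegral_lintegral_swap (hmeas.aemeasurable.mul (hg.restrict.comp_fst))]
  refine setLIntegral_mono' measurableSet_Ioi fun r hr => ?_
  calc ∫⁻ y in (Metric.ball x R)ᶜ, h (y, r) * g y
      ≤ ∫⁻ y, h (y, r) * g y := setLIntegral_le_lintegral _ _
    _ = ∫⁻ y in Metric.ball x r, ENNReal.ofReal (b * r ^ (-b - 1)) * g y := by
        rw [← lintegral_indicator Metric.isOpen_ball.measurableSet]
        refine lintegral_congr fun y => ?_
        by_cases hy : y ∈ Metric.ball x r
        · have : ‖x - y‖ < r := by rwa [← dist_eq_norm, dist_comm]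
          simp [hh, indicator, hy, this]
        · have : ¬ ‖x - y‖ < r := by rwa [← dist_eq_norm, dist_comm]
          simp only [hh, indicator, mem_ofPred_eq, this, if_false, hy, zero_mul]
    _ = ENNReal.ofReal (b * r ^ (-b - 1)) * ∫⁻ y in Metric.ball x r, g y :=
        lintegral_const_mul' _ _ ENNReal.ofReal_ne_top
    _ ≤ _ := by gcongr; exact hw r hr

theorem div_conjExponent {t : ℝ} (ht : 1 < t) (c : ℝ) : c / t.conjExponent = c - c / t := by
  have : t - 1 ≠ 0 := by linarith
  rw [Real.conjExponent]
  field_simp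

/-- Since n - n/t = n/t', the layer-cake integrand is a constant times the one in condition (i). -/
theorem lintegral_Ioi_morrey_tail_le {t C₁ R : ℝ} {φ : ℝ → ℝ} (ht : 1 < t) (hR : 0 < R)
    (hφ : ∀ r : ℝ, 0 < r → 0 < φ r)
    (h_i : ∫⁻ r in Ioi R, ENNReal.ofReal (φ r * r ^ ((n : ℝ) / t.conjExponent - 1)) ≤
        ENNReal.ofReal (C₁ * (φ R * R ^ ((n : ℝ) / t.conjExponent)))) {N : ℝ≥0∞} (hN : N ≠ ∞) :
    ∫⁻ r in Ioi R, ENNReal.ofReal ((n : ℝ) / t * r ^ (-((n : ℝ) / t) - 1)) *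
      (ENNReal.ofReal (unitBallVolume n * r ^ (n : ℝ)) * (ENNReal.ofReal (φ r) * N)) ≤
    ENNReal.ofReal ((n : ℝ) / t * unitBallVolume n *
      (C₁ * (φ R * R ^ ((n : ℝ) / t.conjExponent)))) * N := by
  have hω := unitBallVolume_pos n
  have ht0 : 0 < t := by linarith
  have hcongr : ∀ r ∈ Ioi R, ENNReal.ofReal ((n : ℝ) / t * r ^ (-((n : ℝ) / t) - 1)) *
      (ENNReal.ofReal (unitBallVolume n * r ^ (n : ℝ)) * (ENNReal.ofReal (φ r) * N)) =
      ENNReal.ofReal ((n : ℝ) / t * unitBallVolume n) *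
        ENNReal.ofReal (φ r * r ^ ((n : ℝ) / t.conjExponent - 1)) * N := by
    intro r hr
    have hr0 : 0 < r := hR.trans hr
    have := hφ r hr0
    rw [← mul_assoc, ← mul_assoc, ← ENNReal.ofReal_mul (by positivity),
      ← ENNReal.ofReal_mul (by positivity), ← ENNReal.ofReal_mul (by positivity),
      div_conjExponent ht, show (n : ℝ) - n / t - 1 = (-(n / t) - 1) + n by ring,
      Real.rpow_add hr0]
    congr 2
    ring
  rw [setLIntegral_congr_fun measurableSet_Ioi hcongr, lintegral_mul_const' _ _ hN,
    lintegral_const_mul' _ _ ENNReal.ofReal_ne_top,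
    ENNReal.ofReal_mul (p := (n : ℝ) / t * unitBallVolume n) (by positivity)]
  gcongr

/-- The local estimate behind the boundedness of convolution operators on Morrey spaces: the mean
over a ball of the potential of `f` with a radially decreasing kernel `K`. -/
theorem exists_average_lintegral_conv_le (hn : 1 ≤ n) {p s t : ℝ} {φ : ℝ → ℝ} (hp : 1 ≤ p)
    (hs : 1 < s) (hst : s ≤ t) (hφ : ∀ r : ℝ, 0 < r → 0 < φ r) (hdec : AlmostDecreasing φ)
    (h_i : ∃ C₁ : ℝ, 0 < C₁ ∧ ∀ R : ℝ, 0 < R →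
      ∫⁻ r in Ioi R, ENNReal.ofReal (φ r * r ^ ((n : ℝ) / t.conjExponent - 1)) ≤
        ENNReal.ofReal (C₁ * (φ R * R ^ ((n : ℝ) / t.conjExponent)))) :
    ∃ C : ℝ, 0 < C ∧ ∀ (q : ℝ), 1 ≤ q → 1 / q = 1 / p + 1 / s - 1 →
      ∀ (K : EuclideanSpace ℝ (Fin n) → F'), StronglyMeasurable K → morreyNorm s t K < ∞ →
      (∀ x z : EuclideanSpace ℝ (Fin n), z ≠ 0 → ‖z‖ ≤ ‖x‖ → ‖K x‖ₑ ≤ ‖K z‖ₑ) →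
      ∀ (f : EuclideanSpace ℝ (Fin n) → F), AEStronglyMeasurable f volume →
      genMorreyNorm p φ f < ∞ →
      ∀ (a : EuclideanSpace ℝ (Fin n)) (R : ℝ), 0 < R →
        ((volume (Metric.ball a R))⁻¹ * ∫⁻ x in Metric.ball a R,
            (∫⁻ y, ‖K (x - y)‖ₑ * ‖f y‖ₑ) ^ q) ^ (1 / q) ≤
          ENNReal.ofReal (φ R * R ^ ((n : ℝ) / t.conjExponent)) *
            (ENNReal.ofReal C * morreyNorm s t K * genMorreyNorm p φ f) := by
  obtain ⟨Cd, hCd, hdec⟩ := hdec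
  obtain ⟨C₁, hC₁, h_i⟩ := h_i
  have hω := unitBallVolume_pos n
  have hn0 : (0 : ℝ) < n := by exact_mod_cast hn
  have ht1 : 1 < t := hs.trans_le hst
  have ht0 : 0 < t := by linarith
  have hs0 : 0 < s := by linarith
  have hp0 : 0 < p := by linarith
  have : Nonempty (Fin n) := ⟨⟨0, hn⟩⟩
  set ω := unitBallVolume n with hωdef
  -- Near part: 3 and 2 come from the radii 3R and 2R, `Cd⁻¹` from φ(2R) ≤ Cd⁻¹ φ(R).
  set C' := ω ^ (1 - 1 / t) * 3 ^ ((n : ℝ) * (1 / s - 1 / t)) * 2 ^ ((n : ℝ) * (1 / p)) * Cd⁻¹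
    with hC'
  -- Far part: the constant of the pointwise decay of K times that of the tail integral.
  set C'' := ω ^ (-(1 / t)) * ((n : ℝ) / t * ω * C₁) with hC''
  refine ⟨C' + C'', by positivity, ?_⟩
  intro q hq hpqs K hK hKfin hKrad f hf hffin a R hR
  have hq0 : 0 < q := by linarith
  set M := morreyNorm s t K with hM
  set N := genMorreyNorm p φ f with hN
  set e := (n : ℝ) / t.conjExponent with he
  set B := Metric.ball a R with hB
  have hBm : MeasurableSet B := Metric.isOpen_ball.measurableSet
  have hB0 : volume B ≠ 0 := volume_ball_ne_zero a hR
  have hBt : volume B ≠ ∞ := measure_ball_lt_top.ne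
  have hφR := hφ R hR
  set k : EuclideanSpace ℝ (Fin n) → ℝ≥0∞ := fun z => ‖K z‖ₑ with hk
  have hkm : Measurable k := hK.enorm
  set k₁ : EuclideanSpace ℝ (Fin n) → ℝ≥0∞ := (Metric.ball 0 (3 * R)).indicator k with hk₁
  set g₁ : EuclideanSpace ℝ (Fin n) → ℝ≥0∞ :=
    (Metric.ball a (2 * R)).indicator fun y => ‖f y‖ₑ with hg₁
  have hk₁m : Measurable k₁ := hkm.indicator Metric.isOpen_ball.measurableSet
  have hg₁m : AEMeasurable g₁ volume := hf.enorm.indicator Metric.isOpen_ball.measurableSet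
  set T₁ : EuclideanSpace ℝ (Fin n) → ℝ≥0∞ := fun x => ∫⁻ y, k₁ (x - y) * g₁ y with hT₁
  have hT₁m : AEMeasurable T₁ volume :=
    AEMeasurable.lintegral_prod_right' (f := fun z : EuclideanSpace ℝ (Fin n) ×
      EuclideanSpace ℝ (Fin n) => k₁ (z.1 - z.2) * g₁ z.2)
      ((hk₁m.comp (measurable_fst.sub measurable_snd)).aemeasurable.mul hg₁m.comp_snd)
  set D : ℝ≥0∞ := ENNReal.ofReal (C'' * (φ R * R ^ e)) * (M * N) with hD
  have hkw : ∀ z : EuclideanSpace ℝ (Fin n), z ≠ 0 →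
      k z ≤ ENNReal.ofReal (ω ^ (-(1 / t)) * ‖z‖ ^ (-((n : ℝ) / t))) * M := fun z hz =>
    enorm_le_of_radial_of_centered_le (t := t) (M := M) hn hs0 hKrad
      (fun r hr => le_iSup_of_le 0 (le_iSup_of_le r (le_iSup_of_le hr le_rfl))) hz
  have hfar : ∀ x ∈ B, ∫⁻ y in (Metric.ball a (2 * R))ᶜ, k (x - y) * ‖f y‖ₑ ≤ D := by
    intro x hx
    -- Recentring at x makes the tail estimate apply, with a bound `D` that does not depend on x in
    -- B(a,R).
    have hsub : (Metric.ball a (2 * R))ᶜ ⊆ (Metric.ball x R)ᶜ :=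
      compl_subset_compl.2 (Metric.ball_subset_ball' (by
        have := Metric.mem_ball.1 hx; linarith))
    calc ∫⁻ y in (Metric.ball a (2 * R))ᶜ, k (x - y) * ‖f y‖ₑ
        ≤ ∫⁻ y in (Metric.ball x R)ᶜ, k (x - y) * ‖f y‖ₑ := lintegral_mono_set hsub
      _ ≤ ∫⁻ y in (Metric.ball x R)ᶜ, (ENNReal.ofReal (ω ^ (-(1 / t))) * M) *
          (ENNReal.ofReal (‖x - y‖ ^ (-((n : ℝ) / t))) * ‖f y‖ₑ) := by
          refine setLIntegral_mono' Metric.isOpen_ball.measurableSet.compl fun y hy => ?_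
          have hxy : x - y ≠ 0 := by
            rintro h0
            rw [sub_eq_zero] at h0
            exact hy (h0 ▸ Metric.mem_ball_self hR)
          refine (mul_le_mul_left (hkw _ hxy) _).trans_eq ?_
          rw [ENNReal.ofReal_mul (by positivity)]
          ring
      _ = (ENNReal.ofReal (ω ^ (-(1 / t))) * M) * ∫⁻ y in (Metric.ball x R)ᶜ,
          ENNReal.ofReal (‖x - y‖ ^ (-((n : ℝ) / t))) * ‖f y‖ₑ :=
          lintegral_const_mul' _ _ (ENNReal.mul_ne_top ENNReal.ofReal_ne_top hKfin.ne)
      _ ≤ (ENNReal.ofReal (ω ^ (-(1 / t))) * M) *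
          (ENNReal.ofReal ((n : ℝ) / t * ω * (C₁ * (φ R * R ^ e))) * N) := by
          gcongr
          refine (lintegral_compl_ball_norm_rpow_mul_le (by positivity) hR hf.enorm x
            fun r hr => ?_).trans (lintegral_Ioi_morrey_tail_le ht1 hR hφ (h_i R hR) hffin.ne)
          have hr0 := hR.trans hr
          rw [← volume_ball_eq x hr0]
          exact lintegral_ball_le_genMorreyNorm hp hf x hr0 (hφ r hr0)
      _ = D := by
          rw [hD, hC'', show ω ^ (-(1 / t)) * ((n : ℝ) / t * ω * C₁) * (φ R * R ^ e) =
            ω ^ (-(1 / t)) * ((n : ℝ) / t * ω * (C₁ * (φ R * R ^ e))) by ring,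
            ENNReal.ofReal_mul (p := ω ^ (-(1 / t))) (by positivity)]
          ring
  have hsplit : ∀ x ∈ B, ∫⁻ y, k (x - y) * ‖f y‖ₑ ≤ T₁ x + D := by
    intro x hx
    rw [← lintegral_add_compl _
      (Metric.isOpen_ball.measurableSet : MeasurableSet (Metric.ball a (2 * R)))]
    refine add_le_add ?_ (hfar x hx)
    rw [← lintegral_indicator Metric.isOpen_ball.measurableSet]
    refine lintegral_mono fun y => ?_
    by_cases hy : y ∈ Metric.ball a (2 * R)
    · have hxy : x - y ∈ Metric.ball (0 : EuclideanSpace ℝ (Fin n)) (3 * R) := by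
        rw [mem_ball_zero_iff, ← dist_eq_norm]
        have h1 := Metric.mem_ball.1 hx
        have h2 := Metric.mem_ball'.1 hy
        linarith [dist_triangle x a y]
      rw [indicator_of_mem hy, hk₁, hg₁, indicator_of_mem hy, indicator_of_mem hxy]
    · rw [indicator_of_notMem hy]; exact zero_le
  have hyoung : (∫⁻ x, T₁ x ^ q) ^ (1 / q) ≤
      volume B ^ (1 / q) * (ENNReal.ofReal (C' * (φ R * R ^ e)) * (M * N)) := by
    have h3R : 0 < 3 * R := by positivity
    have h2R : 0 < 2 * R := by positivity
    refine (lintegral_conv_Lp_le hk₁m hg₁m hp hs.le hq0 hpqs).trans ?_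
    have e1 : (∫⁻ x, k₁ x ^ s) ^ (1 / s) ≤
        ENNReal.ofReal (ω ^ (1 / s - 1 / t) * (3 * R) ^ ((n : ℝ) * (1 / s - 1 / t))) * M := by
      have h1 : ∫⁻ x, k₁ x ^ s = ∫⁻ x in Metric.ball 0 (3 * R), ‖K x‖ₑ ^ s := by
        rw [← lintegral_indicator Metric.isOpen_ball.measurableSet]
        refine lintegral_congr fun x => ?_
        by_cases hx : x ∈ Metric.ball (0 : EuclideanSpace ℝ (Fin n)) (3 * R) <;>
          simp [hk₁, hk, indicator, hx, hs0]
      rw [h1, hωdef, ← volume_ball_rpow 0 h3R]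
      have h2 : volume (Metric.ball (0 : EuclideanSpace ℝ (Fin n)) (3 * R)) ^ (1 / t - 1 / s) *
          (∫⁻ x in Metric.ball 0 (3 * R), ‖K x‖ₑ ^ s) ^ (1 / s) ≤ M :=
        le_iSup_of_le 0 (le_iSup_of_le (3 * R) (le_iSup_of_le h3R le_rfl))
      refine le_trans (le_of_eq ?_) (mul_le_mul_right h2 _)
      rw [← mul_assoc, ← ENNReal.rpow_add _ _ (volume_ball_ne_zero _ h3R) measure_ball_lt_top.ne,
        sub_add_sub_cancel, sub_self, ENNReal.rpow_zero, one_mul]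
    have e2 : (∫⁻ x, g₁ x ^ p) ^ (1 / p) ≤
        ENNReal.ofReal (ω ^ (1 / p) * (2 * R) ^ ((n : ℝ) * (1 / p)) * (Cd⁻¹ * φ R)) * N := by
      have h1 : ∫⁻ x, g₁ x ^ p = ∫⁻ x in Metric.ball a (2 * R), ‖f x‖ₑ ^ p := by
        rw [← lintegral_indicator Metric.isOpen_ball.measurableSet]
        refine lintegral_congr fun x => ?_
        by_cases hx : x ∈ Metric.ball a (2 * R) <;> simp [hg₁, indicator, hx, hp0]
      rw [h1]
      refine (lintegral_ball_rpow_le_genMorreyNorm hp0 f a h2R (hφ _ h2R)).trans ?_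
      rw [volume_ball_rpow a h2R, ← hωdef, ENNReal.ofReal_mul
        (p := ω ^ (1 / p) * (2 * R) ^ ((n : ℝ) * (1 / p))) (by positivity), mul_assoc]
      gcongr
      rw [← div_eq_inv_mul, le_div_iff₀ hCd, mul_comm]
      exact hdec R (2 * R) hR (by linarith)
    refine (mul_le_mul' e1 e2).trans_eq ?_
    rw [hB, volume_ball_rpow a hR, mul_mul_mul_comm, ← ENNReal.ofReal_mul (by positivity),
      ← mul_assoc (ENNReal.ofReal _) (ENNReal.ofReal _) (M * N),
      ← ENNReal.ofReal_mul (by positivity)]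
    congr 2
    -- The powers of ω and of R match through 1/q = 1/p + 1/s - 1.
    have hω' : ω ^ (1 / s - 1 / t) * ω ^ (1 / p) = ω ^ (1 / q) * ω ^ (1 - 1 / t) := by
      rw [← Real.rpow_add hω, ← Real.rpow_add hω, hpqs]; congr 1; ring
    have hR' : R ^ ((n : ℝ) * (1 / s - 1 / t)) * R ^ ((n : ℝ) * (1 / p)) =
        R ^ ((n : ℝ) * (1 / q)) * R ^ e := by
      rw [← Real.rpow_add hR, ← Real.rpow_add hR, he, div_conjExponent ht1, hpqs]
      congr 1; ring
    rw [Real.mul_rpow (by norm_num) hR.le, Real.mul_rpow (by norm_num) hR.le, hC']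
    linear_combination (3 ^ ((n : ℝ) * (1 / s - 1 / t)) * 2 ^ ((n : ℝ) * (1 / p)) * Cd⁻¹ * φ R) *
      (R ^ ((n : ℝ) * (1 / s - 1 / t)) * R ^ ((n : ℝ) * (1 / p)) * hω' +
        ω ^ (1 / q) * ω ^ (1 - 1 / t) * hR')
  rw [ENNReal.mul_rpow_of_nonneg _ _ (by positivity), ENNReal.inv_rpow,
    ENNReal.inv_mul_le_iff (by simp [hB0, hBt, hq0]) (by simp [hB0, hBt])]
  calc (∫⁻ x in B, (∫⁻ y, ‖K (x - y)‖ₑ * ‖f y‖ₑ) ^ q) ^ (1 / q)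
      ≤ (∫⁻ x in B, (T₁ + (fun _ => D : EuclideanSpace ℝ (Fin n) → ℝ≥0∞)) x ^ q) ^ (1 / q) := by
        refine ENNReal.rpow_le_rpow (setLIntegral_mono' hBm fun x hx => ?_) (by positivity)
        exact ENNReal.rpow_le_rpow (hsplit x hx) hq0.le
    _ ≤ (∫⁻ x in B, T₁ x ^ q) ^ (1 / q) + (∫⁻ x in B, D ^ q) ^ (1 / q) :=
        ENNReal.lintegral_Lp_add_le hT₁m.restrict aemeasurable_const hq
    _ ≤ volume B ^ (1 / q) * (ENNReal.ofReal (C' * (φ R * R ^ e)) * (M * N)) +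
        volume B ^ (1 / q) * D := by
        refine add_le_add ((ENNReal.rpow_le_rpow (setLIntegral_le_lintegral _ _)
          (by positivity)).trans hyoung) (le_of_eq ?_)
        rw [setLIntegral_const, ENNReal.mul_rpow_of_nonneg _ _ (by positivity),
          ← ENNReal.rpow_mul, mul_one_div_cancel hq0.ne', ENNReal.rpow_one, mul_comm]
    _ = _ := by
        rw [hD, ← mul_add, ← add_mul, ← ENNReal.ofReal_add (by positivity) (by positivity),
          ← add_mul, ENNReal.ofReal_mul (by positivity)]
        ring

end

/-! ### Comparison of p with s, and indicators of balls as test functions. -/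

section

/-- The two Dini-type conditions on `φ` near the origin force `p < s`. -/
theorem lt_of_lintegral_Ioo_ne_top {p s : ℝ} {φ : ℝ → ℝ} (hp : 0 < p) (hs : 1 < s)
    (hφ : ∀ r : ℝ, 0 < r → 0 < φ r) (hm : AEMeasurable φ (volume.restrict (Ioi (0 : ℝ))))
    (h₁ : ∫⁻ r in Ioo 0 1, ENNReal.ofReal (φ r ^ p * r ^ ((n : ℝ) - 1)) ≠ ∞)
    (h₂ : ∫⁻ r in Ioo 0 1, ENNReal.ofReal
      (r ^ ((n : ℝ) - 1) / (φ r ^ s.conjExponent * r ^ ((n : ℝ) * s.conjExponent))) ≠ ∞) :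
    p < s := by
  by_contra! hsp
  have hs0 : 0 < s := by linarith
  have hs' : 0 < s.conjExponent := by
    rw [Real.conjExponent]; exact div_pos hs0 (by linarith)
  have hpt : ∀ r ∈ Ioo (0 : ℝ) 1, ENNReal.ofReal (r ^ (-1 : ℝ)) ≤
      ENNReal.ofReal (φ r ^ p * r ^ ((n : ℝ) - 1)) + ENNReal.ofReal
      (r ^ ((n : ℝ) - 1) / (φ r ^ s.conjExponent * r ^ ((n : ℝ) * s.conjExponent))) := by
    rintro r ⟨hr0, hr1⟩
    have hφr := hφ r hr0
    -- If φ(r) r^(n/p) ≥ 1 the first integrand is at least 1/r. Otherwise s ≤ p and r < 1 give φ(r)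
    -- r^(n/s) ≤ 1, and the second is. So the sum dominates 1/r, which is not integrable at 0.
    rcases le_or_gt 1 (φ r * r ^ ((n : ℝ) / p)) with hu | hu
    · refine le_add_right (ENNReal.ofReal_le_ofReal ?_)
      have h : 1 ≤ φ r ^ p * r ^ (n : ℝ) := by
        have := Real.one_le_rpow hu hp.le
        rwa [Real.mul_rpow hφr.le (by positivity), ← Real.rpow_mul hr0.le,
          div_mul_cancel₀ _ hp.ne'] at this
      rw [sub_eq_add_neg, Real.rpow_add hr0, ← mul_assoc]
      exact le_mul_of_one_le_left (by positivity) h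
    · refine le_add_left (ENNReal.ofReal_le_ofReal ?_)
      have hv : φ r * r ^ ((n : ℝ) / s) ≤ 1 := by
        refine le_trans ?_ hu.le
        gcongr φ r * ?_
        exact Real.rpow_le_rpow_of_exponent_ge hr0 hr1.le (by gcongr)
      have h : φ r ^ s.conjExponent * r ^ ((n : ℝ) * s.conjExponent) ≤ r ^ (n : ℝ) := by
        have h1 : (n : ℝ) * s.conjExponent = n / s * s.conjExponent + n := by
          have : s - 1 ≠ 0 := by linarith
          rw [Real.conjExponent]; field_simp; ring
        rw [h1, Real.rpow_add hr0, ← mul_assoc, Real.rpow_mul hr0.le,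
          ← Real.mul_rpow hφr.le (by positivity)]
        exact mul_le_of_le_one_left (by positivity)
          (Real.rpow_le_one (by positivity) hv hs'.le)
      rw [le_div_iff₀ (by positivity)]
      calc _ ≤ r ^ (-1 : ℝ) * r ^ (n : ℝ) := by gcongr
        _ = _ := by rw [← Real.rpow_add hr0]; congr 1; ring
  have hm₁ : AEMeasurable (fun r => ENNReal.ofReal (φ r ^ p * r ^ ((n : ℝ) - 1)))
      (volume.restrict (Ioo (0 : ℝ) 1)) :=
    (((hm.mono_measure (Measure.restrict_mono Ioo_subset_Ioi_self le_rfl)).pow_const p).mul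
      (measurable_id.pow_const _).aemeasurable).ennreal_ofReal
  have hfin : ∫⁻ r in Ioo (0 : ℝ) 1, ENNReal.ofReal (r ^ (-1 : ℝ)) < ∞ :=
    ((setLIntegral_mono' measurableSet_Ioo hpt).trans_eq (lintegral_add_left' hm₁ _)).trans_lt
      (ENNReal.add_lt_top.2 ⟨h₁.lt_top, h₂.lt_top⟩)
  have hint : IntegrableOn (fun r : ℝ => r ^ (-1 : ℝ)) (Ioo 0 1) := by
    refine ⟨(measurable_id.pow_const _).aestronglyMeasurable, ?_⟩
    rw [hasFiniteIntegral_iff_ofReal]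
    · exact hfin
    · filter_upwards [ae_restrict_mem measurableSet_Ioo] with r hr
      exact Real.rpow_nonneg hr.1.le _
  rw [intervalIntegral.integrableOn_Ioo_rpow_iff one_pos] at hint
  exact absurd hint (lt_irrefl _)

/-- The generalized Morrey norm of the indicator of a ball of radius `R` is at most a multiple of
`1 / φ R`. -/
theorem exists_genMorreyNorm_indicator_ball_le {F : Type*} [NormedAddCommGroup F] {p : ℝ}
    {φ : ℝ → ℝ} (hp : 0 < p) (hφ : IsClassG n p φ) :
    ∃ C : ℝ, 0 < C ∧ ∀ (a : EuclideanSpace ℝ (Fin n)) (R : ℝ) (c : F), ‖c‖ₑ = 1 → 0 < R →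
      genMorreyNorm p φ ((Metric.ball a R).indicator fun _ => c) ≤ ENNReal.ofReal (C / φ R) := by
  obtain ⟨Cd, hCd, hdec⟩ := hφ.almostDecreasing
  obtain ⟨Ci, hCi, hinc⟩ := hφ.almostIncreasing
  have hω := unitBallVolume_pos n
  refine ⟨Cd⁻¹ + Ci ^ (1 / p), by positivity, fun a₀ R c hc hR => ?_⟩
  have hφR := hφ.pos R hR
  refine iSup_le fun a => iSup_le fun r => iSup_le fun hr => ?_
  have hφr := hφ.pos r hr
  have hB0 := volume_ball_ne_zero a hr
  have hBt : volume (Metric.ball a r) ≠ ∞ := measure_ball_lt_top.ne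
  have hint : ∫⁻ x in Metric.ball a r, ‖(Metric.ball a₀ R).indicator (fun _ => c) x‖ₑ ^ p =
      volume (Metric.ball a₀ R ∩ Metric.ball a r) := by
    rw [← Measure.restrict_apply Metric.isOpen_ball.measurableSet,
      ← lintegral_indicator_one Metric.isOpen_ball.measurableSet]
    refine lintegral_congr fun x => ?_
    by_cases hx : x ∈ Metric.ball a₀ R
    · rw [indicator_of_mem hx, indicator_of_mem hx, hc, ENNReal.one_rpow, Pi.one_apply]
    · rw [indicator_of_notMem hx, indicator_of_notMem hx, enorm_zero, ENNReal.zero_rpow_of_pos hp]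
  rw [hint]
  -- For small balls the mean is at most 1 and φ is almost decreasing; for large ones the mean is at
  -- most (R/r)^n and φ^p(r) r^n is almost increasing.
  rcases le_total r R with hrR | hRr
  · calc _ ≤ (ENNReal.ofReal (φ r))⁻¹ * 1 := by
          gcongr
          refine (ENNReal.rpow_le_one ?_ (by positivity))
          rw [ENNReal.inv_mul_le_iff hB0 hBt, mul_one]
          exact measure_mono inter_subset_right
      _ ≤ _ := by
          rw [mul_one, ← ENNReal.ofReal_inv_of_pos hφr]
          refine ENNReal.ofReal_le_ofReal ?_
          calc (φ r)⁻¹ ≤ (Cd * φ R)⁻¹ := by gcongr; exact hdec r R hr hrR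
            _ = Cd⁻¹ / φ R := by rw [mul_inv, div_eq_mul_inv]
            _ ≤ _ := by gcongr; exact le_add_of_nonneg_right (by positivity)
  · calc _ ≤ (ENNReal.ofReal (φ r))⁻¹ * ((volume (Metric.ball a r))⁻¹ *
          volume (Metric.ball a₀ R)) ^ (1 / p) := by gcongr; exact inter_subset_left
      _ = ENNReal.ofReal ((φ r)⁻¹ * (R ^ (n : ℝ) / r ^ (n : ℝ)) ^ (1 / p)) := by
          rw [volume_ball_eq a hr, volume_ball_eq a₀ hR, ← ENNReal.ofReal_inv_of_pos hφr,
            ← ENNReal.ofReal_inv_of_pos (by positivity), ← ENNReal.ofReal_mul (by positivity),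
            ENNReal.ofReal_rpow_of_pos (by positivity), ← ENNReal.ofReal_mul (by positivity)]
          congr 3
          field_simp
      _ ≤ _ := by
          refine ENNReal.ofReal_le_ofReal ?_
          have h1 : φ R * (R ^ (n : ℝ) / r ^ (n : ℝ)) ^ (1 / p) ≤ Ci ^ (1 / p) * φ r := by
            have h2 : φ R ^ p * (R ^ (n : ℝ) / r ^ (n : ℝ)) ≤ Ci * φ r ^ p := by
              rw [← mul_div_assoc, div_le_iff₀ (by positivity), mul_assoc]
              exact hinc R r hR hRr
            have h3 := Real.rpow_le_rpow (by positivity) h2 (show 0 ≤ 1 / p by positivity)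
            rwa [Real.mul_rpow (by positivity) (by positivity), Real.mul_rpow hCi.le (by positivity),
              ← Real.rpow_mul hφR.le, ← Real.rpow_mul hφr.le, mul_one_div_cancel hp.ne',
              Real.rpow_one, Real.rpow_one] at h3
          rw [inv_mul_le_iff₀ hφr, mul_div_assoc', le_div_iff₀ hφR]
          calc _ = φ R * (R ^ (n : ℝ) / r ^ (n : ℝ)) ^ (1 / p) := mul_comm _ _
            _ ≤ Ci ^ (1 / p) * φ r := h1
            _ ≤ _ := by rw [mul_comm]; gcongr; exact le_add_of_nonneg_left (by positivity)

/-- Admits the test functions into the supremum defining `morreyOpNorm`, which ranges over nonzero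
norms. -/
theorem genMorreyNorm_indicator_ball_ne_zero {F : Type*} [NormedAddCommGroup F] {p : ℝ}
    {φ : ℝ → ℝ} (a : EuclideanSpace ℝ (Fin n)) {R : ℝ} {c : F} (hc : ‖c‖ₑ = 1)
    (hR : 0 < R) :
    genMorreyNorm p φ ((Metric.ball a R).indicator fun _ => c) ≠ 0 := by
  have h : (ENNReal.ofReal (φ R))⁻¹ * ((volume (Metric.ball a R))⁻¹ *
      ∫⁻ x in Metric.ball a R, ‖(Metric.ball a R).indicator (fun _ => c) x‖ₑ ^ p) ^ (1 / p) ≤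
      genMorreyNorm p φ ((Metric.ball a R).indicator fun _ => c) :=
    le_iSup_of_le a (le_iSup_of_le R (le_iSup_of_le hR le_rfl))
  refine fun h0 => ?_
  have hint : ∫⁻ x in Metric.ball a R, ‖(Metric.ball a R).indicator (fun _ => c) x‖ₑ ^ p =
      volume (Metric.ball a R) := by
    rw [setLIntegral_congr_fun (g := fun _ => 1) Metric.isOpen_ball.measurableSet fun x hx => by
      simp only [indicator_of_mem hx, hc, ENNReal.one_rpow], setLIntegral_one]
  rw [h0, hint, ENNReal.inv_mul_cancel (volume_ball_ne_zero a hR) measure_ball_lt_top.ne,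
    ENNReal.one_rpow, mul_one] at h
  simp at h

end

/-! ### Upper and lower bounds for the operator norm. -/

section

variable {𝕜 : Type*} [RCLike 𝕜] {α γ : ℝ}

theorem memLpLoc_indicator_ball {p : ℝ} (a : EuclideanSpace ℝ (Fin n)) (R : ℝ) (c : 𝕜) :
    MemLpLoc p ((Metric.ball a R).indicator fun _ => c) := fun A _ =>
  (memLp_indicator_const _ Metric.isOpen_ball.measurableSet c
    (Or.inr measure_ball_lt_top.ne)).restrict A

theorem enorm_besselRiesz_le (f : EuclideanSpace ℝ (Fin n) → 𝕜) (x : EuclideanSpace ℝ (Fin n)) :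
    ‖besselRiesz α γ f x‖ₑ ≤ ∫⁻ y, ‖besselRieszKernel α γ (x - y)‖ₑ * ‖f y‖ₑ := by
  refine (enorm_integral_le_lintegral_enorm _).trans_eq (lintegral_congr fun y => ?_)
  rw [enorm_smul]

/-- Where the defining integral converges, the potential of the indicator of `S` is the
integral of the translated reflected kernel over `S`. -/
theorem enorm_besselRiesz_indicator (S : Set (EuclideanSpace ℝ (Fin n))) (hS : MeasurableSet S)
    {x : EuclideanSpace ℝ (Fin n)}
    (hx : Integrable fun y => besselRieszKernel α γ (x - y) • S.indicator (fun _ => (1 : 𝕜)) y) :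
    ‖besselRiesz α γ (S.indicator fun _ => (1 : 𝕜)) x‖ₑ =
      ∫⁻ y in S, ‖besselRieszKernel α γ (x - y)‖ₑ := by
  have h1 : ∀ y, besselRieszKernel α γ (x - y) • S.indicator (fun _ => (1 : 𝕜)) y =
      ((S.indicator (fun y => besselRieszKernel α γ (x - y)) y : ℝ) : 𝕜) := by
    intro y
    by_cases hy : y ∈ S
    · rw [indicator_of_mem hy, indicator_of_mem hy, RCLike.real_smul_eq_coe_mul, mul_one]
    · rw [indicator_of_notMem hy, indicator_of_notMem hy, smul_zero, RCLike.ofReal_zero]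
  have hnn : ∀ y, 0 ≤ S.indicator (fun y => besselRieszKernel α γ (x - y)) y :=
    fun y => indicator_nonneg (fun y _ => besselRieszKernel_nonneg _) y
  -- Without integrability the Bochner integral would be 0 while the integral over S is infinite.
  have hint : Integrable (S.indicator fun y => besselRieszKernel α γ (x - y)) := by
    have := hx.re
    simpa only [h1, RCLike.ofReal_re] using this
  rw [besselRiesz]
  simp_rw [h1]
  rw [integral_ofReal, ← ofReal_norm, RCLike.norm_ofReal,
    abs_of_nonneg (integral_nonneg hnn),
    ofReal_integral_eq_lintegral_ofReal hint (Filter.Eventually.of_forall hnn),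
    ← lintegral_indicator hS]
  refine lintegral_congr fun y => ?_
  by_cases hy : y ∈ S
  · rw [indicator_of_mem hy, indicator_of_mem hy, Real.enorm_eq_ofReal (besselRieszKernel_nonneg _)]
  · rw [indicator_of_notMem hy, indicator_of_notMem hy, ENNReal.ofReal_zero]

/-- Boundedness of the Bessel-Riesz operator between generalized Morrey spaces. -/
theorem exists_besselRiesz_bounded (hn : 1 ≤ n) {p s t : ℝ} {φ : ℝ → ℝ} (hp : 1 ≤ p)
    (hs : 1 < s) (hst : s ≤ t) (hφ : ∀ r : ℝ, 0 < r → 0 < φ r) (hdec : AlmostDecreasing φ)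
    (h_i : ∃ C₁ : ℝ, 0 < C₁ ∧ ∀ R : ℝ, 0 < R →
      ∫⁻ r in Ioi R, ENNReal.ofReal (φ r * r ^ ((n : ℝ) / t.conjExponent - 1)) ≤
        ENNReal.ofReal (C₁ * (φ R * R ^ ((n : ℝ) / t.conjExponent)))) :
    ∃ C : ℝ, 0 < C ∧ ∀ α γ q : ℝ, ∀ ψ : ℝ → ℝ, 1 ≤ q → 1 / q = 1 / p + 1 / s - 1 →
      (∀ r : ℝ, 0 < r → ψ r = φ r * r ^ ((n : ℝ) / t.conjExponent)) →
      α ≤ n → 0 ≤ γ → morreyNorm s t (besselRieszKernel (n := n) α γ) < ∞ →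
      ∀ f : EuclideanSpace ℝ (Fin n) → 𝕜, MemGenMorrey p φ f →
        (∀ᵐ x, Integrable fun y => besselRieszKernel α γ (x - y) • f y) ∧
        MemGenMorrey q ψ (besselRiesz α γ f) ∧
        genMorreyNorm q ψ (besselRiesz α γ f) ≤
          ENNReal.ofReal C * morreyNorm s t (besselRieszKernel (n := n) α γ) *
            genMorreyNorm p φ f := by
  obtain ⟨C, hC, hmain⟩ := exists_average_lintegral_conv_le (F := 𝕜) (F' := ℝ) hn hp hs hst hφ
    hdec h_i
  refine ⟨C, hC, fun α γ q ψ hq hpq hψ hα hγ hM f hf => ?_⟩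
  have hq0 : 0 < q := by linarith
  have hfm : AEStronglyMeasurable f volume := hf.1.aestronglyMeasurable
  have hKm : StronglyMeasurable (besselRieszKernel (n := n) α γ) :=
    measurable_besselRieszKernel.stronglyMeasurable
  have hball := hmain q hq hpq _ hKm hM (enorm_besselRieszKernel_le_of_norm_le hα hγ) f hfm hf.2
  set M := morreyNorm s t (besselRieszKernel (n := n) α γ)
  set N := genMorreyNorm p φ f
  set T : EuclideanSpace ℝ (Fin n) → ℝ≥0∞ :=
    fun x => ∫⁻ y, ‖besselRieszKernel α γ (x - y)‖ₑ * ‖f y‖ₑ with hT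
  have hTm : AEMeasurable T volume :=
    AEMeasurable.lintegral_prod_right' (f := fun z : EuclideanSpace ℝ (Fin n) ×
      EuclideanSpace ℝ (Fin n) => ‖besselRieszKernel α γ (z.1 - z.2)‖ₑ * ‖f z.2‖ₑ)
      ((hKm.enorm.comp (measurable_fst.sub measurable_snd)).aemeasurable.mul hfm.enorm.comp_snd)
  -- This one bound yields both almost everywhere convergence and membership in L^q_loc.
  have hfinT : ∀ R : ℝ, 0 < R → ∫⁻ x in Metric.ball 0 R, T x ^ q < ∞ := by
    intro R hR
    have h1 := (hball 0 R hR).trans_lt (ENNReal.mul_lt_top ENNReal.ofReal_lt_top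
      (ENNReal.mul_lt_top (ENNReal.mul_lt_top ENNReal.ofReal_lt_top hM) hf.2))
    rw [ENNReal.rpow_lt_top_iff_of_pos (by positivity)] at h1
    refine lt_top_iff_ne_top.2 fun htop => ?_
    rw [htop, ENNReal.mul_top (ENNReal.inv_ne_zero.2 measure_ball_lt_top.ne)] at h1
    exact lt_irrefl _ h1
  have hIm : AEStronglyMeasurable (besselRiesz α γ f) volume :=
    AEStronglyMeasurable.integral_prod_right' (f := fun z : EuclideanSpace ℝ (Fin n) ×
      EuclideanSpace ℝ (Fin n) => besselRieszKernel α γ (z.1 - z.2) • f z.2)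
      ((measurable_besselRieszKernel.comp (measurable_fst.sub
        measurable_snd)).aestronglyMeasurable.smul hfm.comp_snd)
  have hbound : genMorreyNorm q ψ (besselRiesz α γ f) ≤ ENNReal.ofReal C * M * N := by
    refine iSup_le fun a => iSup_le fun r => iSup_le fun hr => ?_
    have hφr := hφ r hr
    rw [hψ r hr, ENNReal.inv_mul_le_iff (by simp; positivity) ENNReal.ofReal_ne_top]
    refine le_trans ?_ (hball a r hr)
    gcongr with x
    exact enorm_besselRiesz_le f x
  refine ⟨?_, ⟨fun A hA => ?_, ?_⟩, hbound⟩
  · have hTfin : ∀ᵐ x, T x < ∞ := by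
      have h : ∀ᵐ x ∂volume.restrict
          (⋃ k : ℕ, Metric.ball (0 : EuclideanSpace ℝ (Fin n)) ((k : ℝ) + 1)), T x < ∞ := by
        rw [ae_restrict_iUnion_iff]
        intro k
        filter_upwards [ae_lt_top' (hTm.restrict.pow_const q) (hfinT (k + 1) (by positivity)).ne]
          with x hx
        exact (ENNReal.rpow_lt_top_iff_of_pos hq0).1 hx
      have hU : (⋃ k : ℕ, Metric.ball (0 : EuclideanSpace ℝ (Fin n)) ((k : ℝ) + 1)) = univ := by
        refine eq_univ_of_forall fun x => mem_iUnion.2 ?_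
        obtain ⟨k, hk⟩ := exists_nat_gt ‖x‖
        exact ⟨k, by rw [mem_ball_zero_iff]; linarith⟩
      rwa [hU, Measure.restrict_univ] at h
    filter_upwards [hTfin] with x hx
    refine ⟨(measurable_besselRieszKernel.comp
      (measurable_const.sub measurable_id)).aestronglyMeasurable.smul hfm, ?_⟩
    rw [hasFiniteIntegral_iff_enorm]
    simpa only [enorm_smul] using hx
  · obtain ⟨R, hR, hAR⟩ := hA.isBounded.exists_pos_norm_lt
    have hsub : A ⊆ Metric.ball 0 R := fun x hx => mem_ball_zero_iff.2 (hAR x hx)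
    refine MemLp.mono_measure (Measure.restrict_mono hsub le_rfl) ⟨hIm.restrict, ?_⟩
    rw [eLpNorm_lt_top_iff_lintegral_rpow_enorm_lt_top (by simpa using hq0) ENNReal.ofReal_ne_top,
      ENNReal.toReal_ofReal hq0.le]
    refine lt_of_le_of_lt (lintegral_mono fun x => ?_) (hfinT R hR)
    exact ENNReal.rpow_le_rpow (enorm_besselRiesz_le f x) hq0.le
  · exact hbound.trans_lt (ENNReal.mul_lt_top (ENNReal.mul_lt_top ENNReal.ofReal_lt_top hM) hf.2)

/-- Lower bound for the norm of the Bessel-Riesz operator between generalized Morrey spaces. -/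
theorem exists_morreyNorm_besselRieszKernel_le_opNorm (hn : 1 ≤ n) {p t : ℝ} {φ : ℝ → ℝ}
    (hp : 1 ≤ p) (hpt : p < t) (hφ : IsClassG n p φ) :
    ∃ C : ℝ, 0 < C ∧ ∀ α γ q : ℝ, ∀ ψ : ℝ → ℝ, 1 ≤ q →
      (∀ r : ℝ, 0 < r → ψ r = φ r * r ^ ((n : ℝ) / t.conjExponent)) →
      α ≤ n → 0 ≤ γ →
      (∀ f : EuclideanSpace ℝ (Fin n) → 𝕜, MemGenMorrey p φ f →
        ∀ᵐ x, Integrable fun y => besselRieszKernel α γ (x - y) • f y) →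
      ENNReal.ofReal C * morreyNorm p t (besselRieszKernel (n := n) α γ) ≤
        morreyOpNorm p φ q ψ (besselRiesz (n := n) (𝕜 := 𝕜) α γ) := by
  have hp0 : 0 < p := by linarith
  have ht1 : 1 < t := by linarith
  have ht0 : 0 < t := by linarith
  have hω := unitBallVolume_pos n
  have : Nonempty (Fin n) := ⟨⟨0, hn⟩⟩
  obtain ⟨Cχ, hCχ, hχ⟩ := exists_genMorreyNorm_indicator_ball_le (F := 𝕜) hp0 hφ
  obtain ⟨c, hc, hcb⟩ := exists_morreyNorm_norm_rpow_le hn hp0 hpt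
  set ω := unitBallVolume n with hωdef
  set e := (n : ℝ) / t.conjExponent with he
  set C₆ := ω ^ (1 / t - 1 / 1) * (Cχ * 2 ^ (n : ℝ) * 2 ^ e) with hC₆
  refine ⟨(ω ^ (-(1 / t)) * C₆ * c)⁻¹, by positivity, fun α γ q ψ hq hψ hα hγ hint => ?_⟩
  have hq0 : 0 < q := by linarith
  set P := morreyOpNorm p φ q ψ (besselRiesz (n := n) (𝕜 := 𝕜) α γ) with hP
  -- Finiteness of P is needed later to use it as a constant in `morreyNorm_le_mul`.
  by_cases hPtop : P = ∞
  · rw [hPtop]; exact le_top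
  have hkey : ∀ R : ℝ, 0 < R → ∫⁻ z in Metric.ball (0 : EuclideanSpace ℝ (Fin n)) R,
      ‖besselRieszKernel α γ z‖ₑ ≤ ENNReal.ofReal (Cχ * 2 ^ (n : ℝ) * (2 * R) ^ e) * P := by
    intro R hR
    have h2R : 0 < 2 * R := by positivity
    have hφ2 := hφ.pos _ h2R
    set B := Metric.ball (0 : EuclideanSpace ℝ (Fin n)) R with hB
    set B₂ := Metric.ball (0 : EuclideanSpace ℝ (Fin n)) (2 * R) with hB₂
    set f : EuclideanSpace ℝ (Fin n) → 𝕜 := B₂.indicator fun _ => 1 with hf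
    set J := ∫⁻ z in B, ‖besselRieszKernel α γ z‖ₑ with hJ
    have hNle : genMorreyNorm p φ f ≤ ENNReal.ofReal (Cχ / φ (2 * R)) :=
      hχ 0 (2 * R) 1 (by simp) h2R
    have hN0 : genMorreyNorm p φ f ≠ 0 :=
      genMorreyNorm_indicator_ball_ne_zero 0 (by simp) h2R
    have hNt : genMorreyNorm p φ f ≠ ∞ := (hNle.trans_lt ENNReal.ofReal_lt_top).ne
    have hfmem : MemGenMorrey p φ f := ⟨memLpLoc_indicator_ball _ _ _, hNt.lt_top⟩
    have hPf : genMorreyNorm q ψ (besselRiesz α γ f) ≤ P * genMorreyNorm p φ f := by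
      rw [← ENNReal.div_le_iff hN0 hNt]
      exact le_iSup_of_le f (le_iSup_of_le hfmem (le_iSup_of_le hN0 le_rfl))
    -- For x in B(0,R) the reflected translate x - B(0,R) lies inside B(0,2R), where f = 1.
    have hlow : ∀ᵐ x, x ∈ B → J ≤ ‖besselRiesz α γ f x‖ₑ := by
      filter_upwards [hint f hfmem] with x hx hxB
      rw [enorm_besselRiesz_indicator B₂ Metric.isOpen_ball.measurableSet hx, hJ,
        ← lintegral_indicator Metric.isOpen_ball.measurableSet,
        ← lintegral_indicator Metric.isOpen_ball.measurableSet,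
        ← lintegral_sub_left_eq_self _ x]
      refine lintegral_mono fun y => ?_
      by_cases hy : x - y ∈ B
      · have hy2 : y ∈ B₂ := by
          rw [hB₂, mem_ball_zero_iff]
          rw [hB, mem_ball_zero_iff] at hy hxB
          calc ‖y‖ = ‖x - (x - y)‖ := by rw [sub_sub_cancel]
            _ ≤ ‖x‖ + ‖x - y‖ := norm_sub_le _ _
            _ < 2 * R := by linarith
        rw [indicator_of_mem hy, indicator_of_mem hy2]
      · rw [indicator_of_notMem hy]; exact zero_le
    have h1 : (ENNReal.ofReal (ψ (2 * R)))⁻¹ * ((volume B₂)⁻¹ *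
        ∫⁻ x in B₂, ‖besselRiesz α γ f x‖ₑ ^ q) ^ (1 / q) ≤ genMorreyNorm q ψ (besselRiesz α γ f) :=
      le_iSup_of_le 0 (le_iSup_of_le (2 * R) (le_iSup_of_le h2R le_rfl))
    have h2 : ENNReal.ofReal ((2 : ℝ) ^ (-(n : ℝ))) * J ≤ ((volume B₂)⁻¹ *
        ∫⁻ x in B₂, ‖besselRiesz α γ f x‖ₑ ^ q) ^ (1 / q) := by
      calc ENNReal.ofReal ((2 : ℝ) ^ (-(n : ℝ))) * J
          -- Because q ≥ 1, the volume ratio 2^(-n) may replace its 1/q-th power, which keeps q out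
          -- of the constant.
          ≤ ENNReal.ofReal ((2 : ℝ) ^ (-(n : ℝ))) ^ (1 / q) * J := by
            gcongr
            rw [ENNReal.ofReal_rpow_of_pos (by positivity), ← Real.rpow_mul (by norm_num)]
            refine ENNReal.ofReal_le_ofReal
              (Real.rpow_le_rpow_of_exponent_le (by norm_num) ?_)
            have : 1 / q ≤ 1 := by rw [div_le_one hq0]; exact hq
            have hn0 : (0 : ℝ) ≤ n := by positivity
            nlinarith
        _ = ((volume B₂)⁻¹ * ∫⁻ x in B, J ^ q) ^ (1 / q) := by
            rw [setLIntegral_const, mul_left_comm, mul_comm, ENNReal.mul_rpow_of_nonneg _ _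
              (by positivity), ← ENNReal.rpow_mul, mul_one_div_cancel hq0.ne', ENNReal.rpow_one,
              hB, hB₂, volume_ball_eq _ hR, volume_ball_eq _ h2R, ← hωdef,
              ← ENNReal.ofReal_inv_of_pos (by positivity), ← ENNReal.ofReal_mul (by positivity)]
            congr 3
            rw [Real.mul_rpow (by norm_num) hR.le, Real.rpow_neg (by norm_num)]
            field_simp
        _ ≤ _ := by
            have hBB : B ⊆ B₂ := Metric.ball_subset_ball (by linarith)
            gcongr ((volume B₂)⁻¹ * ?_) ^ (1 / q)
            refine le_trans (lintegral_mono_ae ?_) (lintegral_mono_set hBB)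
            filter_upwards [ae_restrict_mem Metric.isOpen_ball.measurableSet,
              ae_restrict_of_ae hlow] with x hxB hx
            exact ENNReal.rpow_le_rpow (hx hxB) hq0.le
    have hψ0 : 0 < ψ (2 * R) := by rw [hψ _ h2R]; positivity
    have h3 : (ENNReal.ofReal (ψ (2 * R)))⁻¹ * (ENNReal.ofReal ((2 : ℝ) ^ (-(n : ℝ))) * J) ≤
        P * ENNReal.ofReal (Cχ / φ (2 * R)) :=
      (mul_le_mul_right h2 _).trans (h1.trans (hPf.trans (mul_le_mul_right hNle _)))
    rw [← ENNReal.ofReal_inv_of_pos hψ0, ← mul_assoc, ← ENNReal.ofReal_mul (by positivity)] at h3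
    have e1 : ψ (2 * R) * 2 ^ (n : ℝ) * ((ψ (2 * R))⁻¹ * 2 ^ (-(n : ℝ))) = 1 := by
      rw [Real.rpow_neg (by norm_num)]; field_simp
    have e2 : ψ (2 * R) * 2 ^ (n : ℝ) * (Cχ / φ (2 * R)) = Cχ * 2 ^ (n : ℝ) * (2 * R) ^ e := by
      rw [hψ _ h2R]; field_simp
    have h4 := mul_le_mul_right h3 (ENNReal.ofReal (ψ (2 * R) * 2 ^ (n : ℝ)))
    rw [← mul_assoc, ← ENNReal.ofReal_mul (by positivity),
      mul_left_comm _ P, ← ENNReal.ofReal_mul (by positivity), mul_comm P, e1, e2, ENNReal.ofReal_one, one_mul] at h4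
    exact h4
  -- This is the centred Morrey norm with exponents 1 and t; it gives the decay of K, and p < t then
  -- recovers the full norm over all balls.
  have hcent : ∀ R : ℝ, 0 < R →
      volume (Metric.ball (0 : EuclideanSpace ℝ (Fin n)) R) ^ (1 / t - 1 / 1) *
        (∫⁻ x in Metric.ball (0 : EuclideanSpace ℝ (Fin n)) R,
          ‖besselRieszKernel α γ x‖ₑ ^ (1 : ℝ)) ^ (1 / (1 : ℝ)) ≤ ENNReal.ofReal C₆ * P := by
    intro R hR
    simp only [ENNReal.rpow_one, one_div_one]
    refine (mul_le_mul_right (hkey R hR) _).trans_eq ?_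
    rw [volume_ball_rpow _ hR, ← mul_assoc, ← ENNReal.ofReal_mul (by positivity)]
    congr 2
    have hRe : R ^ ((n : ℝ) * (1 / t - 1)) * R ^ e = 1 := by
      rw [← Real.rpow_add hR, he, div_conjExponent ht1,
        show (n : ℝ) * (1 / t - 1) + (n - n / t) = 0 by ring, Real.rpow_zero]
    rw [Real.mul_rpow (by norm_num) hR.le, hC₆, ← hωdef, one_div_one]
    linear_combination ω ^ (1 / t - 1) * Cχ * 2 ^ (n : ℝ) * 2 ^ e * hRe
  have hmor : morreyNorm p t (besselRieszKernel (n := n) α γ) ≤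
      ENNReal.ofReal (ω ^ (-(1 / t))) * (ENNReal.ofReal C₆ * P) * ENNReal.ofReal c := by
    refine (morreyNorm_le_mul (C := ENNReal.ofReal (ω ^ (-(1 / t))) * (ENNReal.ofReal C₆ * P))
      hp0 (ENNReal.mul_ne_top ENNReal.ofReal_ne_top
        (ENNReal.mul_ne_top ENNReal.ofReal_ne_top hPtop))
      (g := fun x : EuclideanSpace ℝ (Fin n) => ‖x‖ ^ (-((n : ℝ) / t))) ?_).trans
      (mul_le_mul_right hcb _)
    filter_upwards [Measure.ae_ne volume (0 : EuclideanSpace ℝ (Fin n))] with x hx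
    refine (enorm_le_of_radial_of_centered_le (t := t) hn one_pos
      (enorm_besselRieszKernel_le_of_norm_le hα hγ) hcent hx).trans_eq ?_
    rw [ENNReal.ofReal_mul (by positivity), Real.enorm_eq_ofReal (by positivity)]
    ring
  rw [ENNReal.ofReal_inv_of_pos (by positivity), ENNReal.inv_mul_le_iff
    (by simp; positivity) ENNReal.ofReal_ne_top]
  refine hmor.trans_eq ?_
  rw [ENNReal.ofReal_mul (p := ω ^ (-(1 / t)) * C₆) (by positivity),
    ENNReal.ofReal_mul (p := ω ^ (-(1 / t))) (by positivity)]
  ring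

end

end

/-! ### The two-sided estimate. -/

theorem theorem3p1 (𝕜 : Type*) [RCLike 𝕜] (n : ℕ) (p₁ s t : ℝ) (φ : ℝ → ℝ)
    (hp₁ : 1 ≤ p₁) (hs : 1 < s) (hst : s ≤ t)
    (hφ : IsClassG n p₁ φ)
    (hρ : AlmostIncreasing fun r => φ r * r ^ (n : ℝ))
    (h_i : ∃ C₁ : ℝ, 0 < C₁ ∧ ∀ R : ℝ, 0 < R →
      ∫⁻ r in Ioi R, ENNReal.ofReal (φ r * r ^ ((n : ℝ) / t.conjExponent - 1)) ≤
        ENNReal.ofReal (C₁ * (φ R * R ^ ((n : ℝ) / t.conjExponent))))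
    (h_ii : ∃ C₂ : ℝ, 0 < C₂ ∧ ∀ R : ℝ, 0 < R →
      ∫⁻ r in Ioo 0 R, ENNReal.ofReal (φ r ^ p₁ * r ^ ((n : ℝ) - 1)) ≤
        ENNReal.ofReal (C₂ * (φ R ^ p₁ * R ^ (n : ℝ))))
    (h_iii : ∃ C₃ : ℝ, 0 < C₃ ∧ ∀ R : ℝ, 0 < R →
      ∫⁻ r in Ioo 0 R, ENNReal.ofReal
          (r ^ ((n : ℝ) - 1) / (φ r ^ s.conjExponent * r ^ ((n : ℝ) * s.conjExponent))) ≤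
        ENNReal.ofReal
          (C₃ * R ^ (n : ℝ) / (φ R ^ s.conjExponent * R ^ ((n : ℝ) * s.conjExponent)))) :
    -- the constants depend on `φ, n, p₁, s, t` but not on `α` and `γ`
    ∃ C₄ C₅ : ℝ, 0 < C₄ ∧ 0 < C₅ ∧
      (∀ α γ p₂ : ℝ, ∀ ψ : ℝ → ℝ, 0 < α → α < n → 0 ≤ γ → p₁ < n / α →
        ((p₁ < t ∧ s < t ∧ t = n / (n - α)) ∨
          (0 < γ ∧ p₁ ≤ t ∧ n / (n + γ - α) < t ∧ t < n / (n - α))) →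
        1 / p₂ = 1 / p₁ - 1 / s.conjExponent →
        (∀ r : ℝ, 0 < r → ψ r = φ r * r ^ ((n : ℝ) / t.conjExponent)) →
        -- the operator is well defined on the whole space, and the norms are finite
        (∀ f : EuclideanSpace ℝ (Fin n) → 𝕜, MemGenMorrey p₁ φ f →
          (∀ᵐ x, Integrable fun y => besselRieszKernel α γ (x - y) • f y) ∧
            MemGenMorrey p₂ ψ (besselRiesz α γ f)) ∧
        morreyNorm s t (besselRieszKernel (n := n) α γ) < ∞ ∧
        ENNReal.ofReal C₄ * morreyNorm p₁ t (besselRieszKernel (n := n) α γ) ≤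
          morreyOpNorm p₁ φ p₂ ψ (besselRiesz (n := n) (𝕜 := 𝕜) α γ) ∧
        morreyOpNorm p₁ φ p₂ ψ (besselRiesz (n := n) (𝕜 := 𝕜) α γ) ≤
          ENNReal.ofReal C₅ * morreyNorm s t (besselRieszKernel (n := n) α γ)) ∧
      (∀ α p₂ : ℝ, ∀ ψ : ℝ → ℝ, 0 < α → α < n → p₁ < n / α →
        p₁ < t → s < t → t = n / (n - α) →
        1 / p₂ = 1 / p₁ - 1 / s.conjExponent →
        (∀ r : ℝ, 0 < r → ψ r = φ r * r ^ ((n : ℝ) / t.conjExponent)) →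
        ENNReal.ofReal C₄ * morreyNorm p₁ t (rieszKernel (n := n) α) ≤
          morreyOpNorm p₁ φ p₂ ψ (fractionalIntegral (n := n) (𝕜 := 𝕜) α) ∧
        morreyOpNorm p₁ φ p₂ ψ (fractionalIntegral (n := n) (𝕜 := 𝕜) α) ≤
          ENNReal.ofReal C₅ * morreyNorm s t (rieszKernel (n := n) α)) := by
  have hs0 : 0 < s := by linarith
  have ht1 : 1 < t := hs.trans_le hst
  have ht0 : 0 < t := by linarith
  have hp0 : 0 < p₁ := by linarith
  rcases Nat.eq_zero_or_pos n with rfl | hn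
  · refine ⟨1, 1, one_pos, one_pos, fun α _ _ _ h1 h2 => ?_, fun α _ _ h1 h2 => ?_⟩ <;>
      exact absurd (h1.trans h2) (by simp)
  have hn0 : (0 : ℝ) < n := by exact_mod_cast hn
  -- Conditions (ii) and (iii) at R = 1. This excludes p₁ = t, which the second alternative alone
  -- would allow.
  have hp₁s : p₁ < s := by
    obtain ⟨C₂, -, h₂⟩ := h_ii
    obtain ⟨C₃, -, h₃⟩ := h_iii
    exact lt_of_lintegral_Ioo_ne_top hp0 hs hφ.pos hφ.aemeasurable
      ((h₂ 1 one_pos).trans_lt ENNReal.ofReal_lt_top).ne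
      ((h₃ 1 one_pos).trans_lt ENNReal.ofReal_lt_top).ne
  obtain ⟨C₅, hC₅, hup⟩ := exists_besselRiesz_bounded (𝕜 := 𝕜) hn hp₁ hs hst hφ.pos
    hφ.almostDecreasing h_i
  obtain ⟨C₄, hC₄, hlow⟩ := exists_morreyNorm_besselRieszKernel_le_opNorm (𝕜 := 𝕜) hn hp₁
    (hp₁s.trans_le hst) hφ
  have main : ∀ α γ p₂ : ℝ, ∀ ψ : ℝ → ℝ, 0 < α → α < n → 0 ≤ γ → p₁ < n / α →
      ((p₁ < t ∧ s < t ∧ t = n / (n - α)) ∨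
        (0 < γ ∧ p₁ ≤ t ∧ n / (n + γ - α) < t ∧ t < n / (n - α))) →
      1 / p₂ = 1 / p₁ - 1 / s.conjExponent →
      (∀ r : ℝ, 0 < r → ψ r = φ r * r ^ ((n : ℝ) / t.conjExponent)) →
      (∀ f : EuclideanSpace ℝ (Fin n) → 𝕜, MemGenMorrey p₁ φ f →
        (∀ᵐ x, Integrable fun y => besselRieszKernel α γ (x - y) • f y) ∧
          MemGenMorrey p₂ ψ (besselRiesz α γ f)) ∧
      morreyNorm s t (besselRieszKernel (n := n) α γ) < ∞ ∧
      ENNReal.ofReal C₄ * morreyNorm p₁ t (besselRieszKernel (n := n) α γ) ≤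
        morreyOpNorm p₁ φ p₂ ψ (besselRiesz (n := n) (𝕜 := 𝕜) α γ) ∧
      morreyOpNorm p₁ φ p₂ ψ (besselRiesz (n := n) (𝕜 := 𝕜) α γ) ≤
        ENNReal.ofReal C₅ * morreyNorm s t (besselRieszKernel (n := n) α γ) := by
    intro α γ p₂ ψ hα hαn hγ hpα hab hp₂ hψ
    have hnα : 0 < (n : ℝ) - α := by linarith
    have hM : morreyNorm s t (besselRieszKernel (n := n) α γ) < ∞ :=
      morreyNorm_besselRieszKernel_lt_top hn hαn hγ hs0 hst
        (hab.imp (fun h => h.2) fun h => h.2.2)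
    have hpq : 1 / p₂ = 1 / p₁ + 1 / s - 1 := by
      rw [hp₂, div_conjExponent hs]; ring
    -- Positivity of 1/p₂ is where p₁ < n/α is needed: 1/p₁ > α/n, while 1/s ≥ 1/t ≥ 1 - α/n.
    have hq : 1 ≤ p₂ := by
      have htα : (n - α) * t ≤ n := by
        rcases hab with ⟨-, -, h⟩ | ⟨-, -, -, h⟩
        · rw [h]; exact (mul_div_cancel₀ _ hnα.ne').le
        · rw [lt_div_iff₀ hnα] at h; linarith
      have h1 : 0 < 1 / p₂ := by
        have h2 : 1 / t ≤ 1 / s := one_div_le_one_div_of_le hs0 hst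
        have h3 : α / n < 1 / p₁ := by
          rw [← one_div_div]; exact one_div_lt_one_div_of_lt hp0 hpα
        have h4 : 1 - α / n ≤ 1 / t := by
          rw [le_div_iff₀ ht0, one_sub_div hn0.ne', div_mul_eq_mul_div, div_le_one hn0]
          exact htα
        linarith
      have h2 : 0 < p₂ := one_div_pos.1 h1
      have h3 : 1 / p₁ ≤ 1 := by rw [div_le_one hp0]; exact hp₁
      have h4 : 1 / s ≤ 1 := by rw [div_le_one hs0]; exact hs.le
      rw [← div_le_one h2]
      linarith
    have hf := hup α γ p₂ ψ hq hpq hψ hαn.le hγ hM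
    refine ⟨fun f h => ⟨(hf f h).1, (hf f h).2.1⟩, hM,
      hlow α γ p₂ ψ hq hψ hαn.le hγ fun f h => (hf f h).1, ?_⟩
    refine iSup_le fun f => iSup_le fun h => iSup_le fun h0 => ?_
    rw [ENNReal.div_le_iff h0 h.2.ne]
    exact (hf f h).2.2
  refine ⟨C₄, C₅, hC₄, hC₅, main, fun α p₂ ψ hα hαn hpα hp₁t hst' ht hp₂ hψ => ?_⟩
  have hK : rieszKernel (n := n) α = besselRieszKernel α 0 := by
    ext x; simp [rieszKernel, besselRieszKernel]
  have hI : fractionalIntegral (n := n) (𝕜 := 𝕜) α = besselRiesz α 0 := by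
    ext f x; simp only [fractionalIntegral, besselRiesz, hK]
  rw [hK, hI]
  exact (main α 0 p₂ ψ hα hαn le_rfl hpα (Or.inl ⟨hp₁t, hst', ht⟩) hp₂ hψ).2.2
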